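/- Let $B\ge 50000$ be an integer. For an odd integer $n>1$ and integers $b,c$ with Jacobi symbols $\left(\frac{b^2+4c}{n}\right)=-1$ and $\left(\frac{-c}{n}\right)=1$, say that $n$ passes the Quadratic Frobenius Test (QFT) with parameters $(b,c)$ if all of the following hold, where powers of $x$ are taken in the ring $\mathbb Z[x]/(n,\,x^2-bx-c)$: 1. no prime $p\le\min\{B,\sqrt n\}$ divides $n$; 2. $n$ is not a perfect square; 3. $x^{(n+1)/2}\in\mathbb Z/n\mathbb Z$; 4. $x^{n+1}=-c$; 5. writing $n^2-1=2^rs$ with $s$ odd, either $x^s=1$, or $x^{2^js}=-1$ for some $0\le j\le r-2$. Let $M(n)$ be the number of pairs $(b,c)$ modulo $n$ such that $\left(\frac{b^2+4c}{n}\right)=-1$ and $\left(\frac{-c}{n}\right)=1$, or $1<\gcd(b^2+4c,n)<n$, or $1<\gcd(c,n)<n$. The integer $n$ is said to pass the Random Quadratic Frobenius Test (RQFT) with probability $\alpha$ if the number of pairs $(b,c)$ with $0\le b,c\le n$ such that $n$ passes the QFT with parameters $(b,c)$ equals $\alpha M(n)$. **Theorem 4.1.** Let $n$ be an odd composite with exactly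 $k$ distinct prime factors, and write $n^2-1=2^rs$ with $s$ odd. Let $G=\prod_{p\mid n}\gcd(p^2-1,s)$, the product being over the distinct primes dividing $n$, and let $J$ be the largest integer such that $2^{J+1}\mid p^2-1$ for every prime $p\mid n$. If $$\frac{n^2}{2^{k(J+1)}\,G}>\frac{B}{2^{3k-1}},$$ then $M(n)>0$ and $n$ passes the RQFT (with this $B$) with probability less than $\frac4B$. -/

import Mathlib

open Polynomial in
/-- The polynomial `x² - b x - c` with coefficients reduced modulo `n`. -/
noncomputable def qftPoly (n : ℕ) (b c : ℤ) : (ZMod n)[X] :=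
  X ^ 2 - C (b : ZMod n) * X - C (c : ZMod n)

/-- The ring `ℤ[x]/(n, x² - b x - c)`, as `(ℤ/nℤ)[x]/(x² - b x - c)`. -/
abbrev QFTRing (n : ℕ) (b c : ℤ) : Type := AdjoinRoot (qftPoly n b c)

/-- The class of `x` in `ℤ[x]/(n, x² - b x - c)`. -/
noncomputable def qftX (n : ℕ) (b c : ℤ) : QFTRing n b c := AdjoinRoot.root (qftPoly n b c)

/-- `(b, c)` are admissible parameters for the Quadratic Frobenius Test of `n`: the Jacobi symbols
of `b² + 4c` and `-c` modulo `n` are `-1` and `1`. -/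
def QFTParams (n : ℕ) (b c : ℤ) : Prop :=
  jacobiSym (b ^ 2 + 4 * c) n = -1 ∧ jacobiSym (-c) n = 1

/-- `n` passes the Quadratic Frobenius Test with trial division bound `B` and parameters `(b, c)`:
the parameters are admissible and none of the five steps declares `n` to be composite. -/
structure PassesQFT (B n : ℕ) (b c : ℤ) : Prop where
  params : QFTParams n b c
  /-- no prime up to `min {B, √n}` divides `n` -/
  step1 : ∀ p : ℕ, p.Prime → p ≤ min B (Nat.sqrt n) → ¬ p ∣ n
  /-- `n` is not a perfect square -/
  step2 : ¬ IsSquare n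
  /-- `x ^ ((n+1)/2)` lies in `ℤ/nℤ` -/
  step3 : ∃ a : ZMod n, qftX n b c ^ ((n + 1) / 2) = algebraMap (ZMod n) (QFTRing n b c) a
  /-- `x ^ (n+1) = -c` -/
  step4 : qftX n b c ^ (n + 1) = -(c : QFTRing n b c)
  /-- with `n² - 1 = 2 ^ r * s`, `s` odd: `x ^ s = 1`, or `x ^ (2 ^ j * s) = -1` for some
  `0 ≤ j ≤ r - 2` -/
  step5 : ∃ r s : ℕ, Odd s ∧ n ^ 2 - 1 = 2 ^ r * s ∧
    (qftX n b c ^ s = 1 ∨ ∃ j : ℕ, j + 2 ≤ r ∧ qftX n b c ^ (2 ^ j * s) = -1)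

/-- The number of pairs `(b, c)` with `0 ≤ b, c ≤ n` such that `n` passes the Quadratic Frobenius
Test with parameters `(b, c)`. -/
noncomputable def qftPassCount (B n : ℕ) : ℕ :=
  Set.ncard {q : ℕ × ℕ | q.1 ≤ n ∧ q.2 ≤ n ∧ PassesQFT B n (q.1 : ℤ) (q.2 : ℤ)}

/-- `M(n)`: the number of pairs `(b, c)` modulo `n` such that `(b, c)` are admissible parameters, or
`gcd (b² + 4c, n)` is a nontrivial divisor of `n`, or `gcd (c, n)` is a nontrivial divisor of `n`. -/
noncomputable def qftPairCount (n : ℕ) : ℕ :=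
  Set.ncard {q : ℕ × ℕ | q.1 < n ∧ q.2 < n ∧
    (QFTParams n (q.1 : ℤ) (q.2 : ℤ) ∨
      (1 < Nat.gcd (q.1 ^ 2 + 4 * q.2) n ∧ Nat.gcd (q.1 ^ 2 + 4 * q.2) n < n) ∨
      (1 < Nat.gcd q.2 n ∧ Nat.gcd q.2 n < n))}

/-- The probability with which `n` passes the Random Quadratic Frobenius Test with bound `B`: the
number `α` such that `n` passes the Quadratic Frobenius Test for exactly `α * M(n)` pairs. -/
noncomputable def rqftProb (B n : ℕ) : ℝ := (qftPassCount B n : ℝ) / (qftPairCount n : ℝ)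

/-! One passing pair already forces every prime of `n` above `B`, so this may be assumed. If `p^2 ∣
n` and `n = m * p`, passing gives `x^(n^2-1) = 1` with exponent `-1` modulo `n`; hence two passing
pairs agreeing modulo `m` coincide (`PassesQFT.lift_unique`). At most `m^2` pairs pass, against
`M(n) ≥ n(m-1)`.

If `n` is squarefree, pairs are counted prime by prime. Where the discriminant is a square, the
roots are `u` and `u^n`, leaving at most `p` of the `p^2` residue pairs: a saving of `1/B`. Where it
is not, the roots lie in `F_{p^2}`, have order dividing `(p^2-1)/2`, and come two to a pair. If
every prime is inert, step 5 restricts the roots further; a geometric sum over `j < J` and the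
hypothesis on `G` bound this family when `k ≥ 3`, and it is empty when `k = 2`. Altogether `B` times
the pass count is at most `0.92 n^2` up to boundary terms.

On the other side `4 M(n) ≥ n^2 - 8n` (`sq_le_qftPairCount`), because the weights `(1 - (D/n))(1 +
(-c/n))`, with `D = b^2 + 4c`, sum to exactly `n^2`. -/

/-! ### Algebraic consequences of passing the test -/

theorem two_pow_mul_odd_unique {r s r' s' : ℕ} (hs : Odd s) (hs' : Odd s')
    (h : 2 ^ r * s = 2 ^ r' * s') : r = r' ∧ s = s' := by
  have key : ∀ {a t : ℕ}, Odd t → (2 ^ a * t).factorization 2 = a := by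
    intro a t ht
    have h2 : ¬ 2 ∣ t := by rwa [← even_iff_two_dvd, Nat.not_even_iff_odd]
    rw [Nat.factorization_mul (by positivity) (by rintro rfl; simp at h2)]
    simp [Nat.prime_two.factorization_self, Nat.factorization_eq_zero_of_not_dvd h2]
  have hr : r = r' := by rw [← key (a := r) hs, h, key hs']
  subst hr
  exact ⟨rfl, Nat.eq_of_mul_eq_mul_left (by positivity) h⟩

/-- Universal property: identities between powers of `x` transfer to any root, in `F_p`, in
`F_{p^2}`, or in the test ring of another pair. -/
theorem exists_qftRing_hom {n : ℕ} {b c : ℤ} {K : Type*} [CommRing K] (φ : ZMod n →+* K) {ξ : K}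
    (hξ : ξ ^ 2 = b * ξ + c) :
    ∃ ψ : QFTRing n b c →+* K, ψ (qftX n b c) = ξ ∧ ∀ a, ψ (algebraMap _ _ a) = φ a := by
  have hev : Polynomial.eval₂ φ ξ (qftPoly n b c) = 0 := by
    simp only [qftPoly, Polynomial.eval₂_sub, Polynomial.eval₂_mul, Polynomial.eval₂_pow,
      Polynomial.eval₂_X, Polynomial.eval₂_C]
    rw [hξ, map_intCast, map_intCast]; ring
  exact ⟨AdjoinRoot.lift φ ξ hev, AdjoinRoot.lift_root hev, fun a => AdjoinRoot.lift_of hev⟩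

theorem PassesQFT.step5_of_decomposition {B n : ℕ} {b c : ℤ} (h : PassesQFT B n b c) {r s : ℕ}
    (hs : Odd s) (hrs : n ^ 2 - 1 = 2 ^ r * s) :
    qftX n b c ^ s = 1 ∨ ∃ j : ℕ, j + 2 ≤ r ∧ qftX n b c ^ (2 ^ j * s) = -1 := by
  obtain ⟨r', s', hs', hrs', h5⟩ := h.step5
  obtain ⟨rfl, rfl⟩ := two_pow_mul_odd_unique hs hs' (hrs.symm.trans hrs')
  exact h5

theorem PassesQFT.qftX_pow {B n : ℕ} {b c : ℤ} (h : PassesQFT B n b c) :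
    qftX n b c ^ (n ^ 2 - 1) = 1 := by
  obtain ⟨r, s, -, hrs, h | ⟨j, hj, h⟩⟩ := h.step5
  · rw [hrs, mul_comm, pow_mul, h, one_pow]
  · obtain ⟨i, rfl⟩ := Nat.exists_eq_add_of_le hj
    rw [hrs, show 2 ^ (j + 2 + i) * s = (2 ^ j * s) * (2 * 2 ^ (i + 1)) by ring, pow_mul, h, pow_mul]
    simp

/-- Passing the test constrains every root of `x² - b x - c` in every `ℤ/nℤ`-algebra. -/
theorem PassesQFT.root_pow_eq {B n : ℕ} {b c : ℤ} (h : PassesQFT B n b c)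
    {K : Type*} [CommRing K] (φ : ZMod n →+* K) {ξ : K} (hξ : ξ ^ 2 = b * ξ + c) :
    (∃ a : ZMod n, ξ ^ ((n + 1) / 2) = φ a) ∧ ξ ^ (n + 1) = -(c : K) ∧ ξ ^ (n ^ 2 - 1) = 1 := by
  obtain ⟨ψ, hx, hψ⟩ := exists_qftRing_hom φ hξ
  refine ⟨?_, ?_, ?_⟩
  · obtain ⟨a, ha⟩ := h.step3
    exact ⟨a, by rw [← hx, ← map_pow, ha, hψ]⟩
  · rw [← hx, ← map_pow, h.step4, map_neg, map_intCast]
  · rw [← hx, ← map_pow, h.qftX_pow, map_one]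

theorem qftX_sq (n : ℕ) (b c : ℤ) :
    qftX n b c ^ 2 = (b : QFTRing n b c) * qftX n b c + (c : QFTRing n b c) := by
  have h : AdjoinRoot.mk (qftPoly n b c) (Polynomial.X ^ 2 -
      Polynomial.C (b : ZMod n) * Polynomial.X - Polynomial.C (c : ZMod n)) = 0 :=
    AdjoinRoot.mk_self
  rw [map_sub, map_sub, map_mul, map_pow, AdjoinRoot.mk_X, AdjoinRoot.mk_C, AdjoinRoot.mk_C,
    map_intCast, map_intCast] at h
  change qftX n b c ^ 2 - (b : QFTRing n b c) * qftX n b c - (c : QFTRing n b c) = 0 at h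
  linear_combination h

theorem qftPoly_monic (n : ℕ) (b c : ℤ) : (qftPoly n b c).Monic := by
  unfold qftPoly; monicity!

theorem qftPoly_degree (n : ℕ) [Nontrivial (ZMod n)] (b c : ℤ) : (qftPoly n b c).degree = 2 := by
  unfold qftPoly; compute_degree!

theorem qftX_linear_eq_zero {n : ℕ} (hn : 1 < n) {b c u v : ℤ}
    (h : (u : QFTRing n b c) * qftX n b c + (v : QFTRing n b c) = 0) :
    (n : ℤ) ∣ u ∧ (n : ℤ) ∣ v := by
  have : Fact (1 < n) := ⟨hn⟩
  have h' : AdjoinRoot.mk (qftPoly n b c)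
      (Polynomial.C (u : ZMod n) * Polynomial.X + Polynomial.C (v : ZMod n)) = 0 := by
    simp only [map_add, map_mul, AdjoinRoot.mk_X, map_intCast]
    exact h
  rw [AdjoinRoot.mk_eq_zero] at h'
  have h0 : Polynomial.C (u : ZMod n) * Polynomial.X + Polynomial.C (v : ZMod n) = 0 := by
    by_contra hne
    refine (qftPoly_monic n b c).not_dvd_of_degree_lt hne ?_ h'
    rw [qftPoly_degree]
    exact lt_of_le_of_lt Polynomial.degree_linear_le (by norm_num)
  have h1 : (u : ZMod n) = 0 := by
    have := congrArg (fun q => Polynomial.coeff q 1) h0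
    simpa only [Polynomial.coeff_add, Polynomial.coeff_C_mul, Polynomial.coeff_X_one, mul_one,
      Polynomial.coeff_C_of_ne_zero one_ne_zero, add_zero, Polynomial.coeff_zero] using this
  have h2 : (v : ZMod n) = 0 := by
    have := congrArg (fun q => Polynomial.coeff q 0) h0
    simpa only [Polynomial.coeff_add, Polynomial.coeff_C_mul, Polynomial.coeff_X_zero, mul_zero,
      Polynomial.coeff_C_zero, zero_add, Polynomial.coeff_zero] using this
  exact ⟨(ZMod.intCast_zmod_eq_zero_iff_dvd u n).1 h1, (ZMod.intCast_zmod_eq_zero_iff_dvd v n).1 h2⟩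

/-! ### Square-zero perturbation of a root -/

theorem add_pow_of_mul_self_eq_zero {R : Type*} [CommRing R] (x z : R) (hz : z * z = 0) (N : ℕ) :
    (x + z) ^ (N + 1) = x ^ (N + 1) + (N + 1 : R) * x ^ N * z := by
  induction N with
  | zero => simp
  | succ N ih =>
    rw [pow_succ, ih]
    push_cast
    linear_combination ((N + 1 : R) * x ^ N) * hz

/-- Newton's correction of a root modulo the square-zero element `m`. -/
theorem root_correction {R : Type*} [CommRing R] {m b c β γ e x : R} (hM : m * m = 0)
    (he : e * (b ^ 2 + 4 * c) = 1) (hx : x ^ 2 = b * x + c) :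
    ∃ z : R, z * z = 0 ∧ (x + z) ^ 2 = (b + m * β) * (x + z) + (c + m * γ) := by
  -- The derivative `2x - b` squares to the discriminant, so its inverse is `(2x - b) e`.
  refine ⟨m * ((β * x + γ) * (2 * x - b) * e), ?_, ?_⟩
  · linear_combination (((β * x + γ) * (2 * x - b) * e) ^ 2 : R) * hM
  · set z : R := m * ((β * x + γ) * (2 * x - b) * e) with hz
    have hzz : z * z = 0 := by
      rw [hz]; linear_combination (((β * x + γ) * (2 * x - b) * e) ^ 2 : R) * hM
    have h1 : z * (2 * x - b) = m * (β * x + γ) := by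
      rw [hz]
      linear_combination (m * (β * x + γ) * e * 4 : R) * hx + (m * (β * x + γ) : R) * he
    have h2 : m * z = 0 := by
      rw [hz]; linear_combination ((β * x + γ) * (2 * x - b) * e : R) * hM
    linear_combination hx + hzz + h1 - (β : R) * h2

/-- If `p ∣ m` and `n = m p`, the passing parameters are determined modulo `n` by their residues
modulo `m`. -/
theorem PassesQFT.lift_unique {B n m p : ℕ} (hn : 1 < n) (hnm : n = m * p) (hpm : p ∣ m)
    {b c β γ : ℤ} (h : PassesQFT B n b c) (h' : PassesQFT B n (b + m * β) (c + m * γ)) :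
    (n : ℤ) ∣ m * β ∧ (n : ℤ) ∣ m * γ := by
  have : NeZero n := ⟨by omega⟩
  have hnR : (n : QFTRing n b c) = 0 := by
    rw [← map_natCast (algebraMap (ZMod n) (QFTRing n b c)) n]; simp
  have hM : (m : QFTRing n b c) * m = 0 := by
    obtain ⟨t, ht⟩ := hpm
    have : m * m = n * t := by rw [hnm]; nth_rw 2 [ht]; ring
    rw [← Nat.cast_mul, this, Nat.cast_mul, hnR, zero_mul]
  have hD : IsCoprime (b ^ 2 + 4 * c) (n : ℤ) := by
    rw [Int.isCoprime_iff_gcd_eq_one]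
    by_contra hc
    have := jacobiSym.eq_zero_iff_not_coprime.2 hc
    rw [h.params.1] at this; simp at this
  obtain ⟨e, f, hef⟩ := hD
  have he : (e : QFTRing n b c) * ((b : QFTRing n b c) ^ 2 + 4 * c) = 1 := by
    have := congrArg (fun z : ℤ => (z : QFTRing n b c)) hef
    push_cast at this
    rw [hnR] at this
    linear_combination this
  have hx2 := qftX_sq n b c
  obtain ⟨z, hzz, hy⟩ := root_correction (β := (β : QFTRing n b c)) (γ := (γ : QFTRing n b c))
    hM he hx2
  have hxN := h.qftX_pow
  have hyN := (h'.root_pow_eq (algebraMap (ZMod n) _) (ξ := qftX n b c + z)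
    (by push_cast; exact hy)).2.2
  have hN : n ^ 2 - 1 = (n ^ 2 - 2) + 1 := by
    have : 2 ^ 2 ≤ n ^ 2 := Nat.pow_le_pow_left hn 2
    omega
  have hNc : ((n ^ 2 - 2 : ℕ) : QFTRing n b c) = -2 := by
    have : 2 ^ 2 ≤ n ^ 2 := Nat.pow_le_pow_left hn 2
    rw [Nat.cast_sub (by omega)]; push_cast; rw [hnR]; ring
  -- The exponent `n^2 - 1` is `-1` in the ring, so `1 = 1 - x^(n^2-2) z`; multiplying by `x` gives
  -- `z = 0`.
  rw [hN, add_pow_of_mul_self_eq_zero _ z hzz, ← hN, hxN, hNc] at hyN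
  have hz0 : z = 0 := by
    rw [hN, pow_succ] at hxN
    linear_combination (-qftX n b c) * hyN - z * hxN
  rw [hz0, add_zero, hx2] at hy
  apply qftX_linear_eq_zero hn (b := b) (c := c)
  push_cast
  linear_combination -hy

/-! ### Inert residue pairs modulo a prime -/

/-- The quotient of two solutions is killed by both exponents, hence by their gcd. -/
theorem card_pow_eq_le {K : Type*} [Field K] [Fintype K] [DecidableEq K] (a E : ℕ) (ha : 0 < a)
    (y : K) (hy : y ≠ 0) :
    (Finset.univ.filter (fun ξ : K => ξ ^ a = 1 ∧ ξ ^ E = y)).card ≤ a.gcd E := by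
  have hg : 0 < a.gcd E := Nat.gcd_pos_of_pos_left _ ha
  rcases (Finset.univ.filter (fun ξ : K => ξ ^ a = 1 ∧ ξ ^ E = y)).eq_empty_or_nonempty with h | h
  · rw [h]; simp
  obtain ⟨ξ₀, h₀⟩ := h
  simp only [Finset.mem_filter, Finset.mem_univ, true_and] at h₀
  have hξ₀ : ξ₀ ≠ 0 := by rintro rfl; simp [ha.ne'] at h₀
  refine le_trans ?_ (Polynomial.card_nthRoots (a.gcd E) (ξ₀ ^ a.gcd E))
  refine le_trans (Finset.card_le_card (t := (Polynomial.nthRoots (a.gcd E) (ξ₀ ^ a.gcd E)).toFinset)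
    ?_) (Multiset.toFinset_card_le _)
  intro ξ hξ
  simp only [Finset.mem_filter, Finset.mem_univ, true_and] at hξ
  rw [Multiset.mem_toFinset, Polynomial.mem_nthRoots hg]
  have h1 : (ξ / ξ₀) ^ a.gcd E = 1 := by
    rw [pow_gcd_eq_one, div_pow, div_pow, hξ.1, hξ.2, h₀.1, h₀.2]
    exact ⟨div_one 1, div_self hy⟩
  rw [div_pow] at h1
  exact eq_of_div_eq_one h1

/-- Conjugation of the roots of a quadratic polynomial with nonsquare discriminant. -/
theorem frobenius_root {p : ℕ} [Fact p.Prime] (hp : p ≠ 2) {K : Type*} [Field K] [Algebra (ZMod p) K]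
    {b c : ZMod p} (hD : ¬ IsSquare (b ^ 2 + 4 * c)) {ξ : K}
    (hξ : ξ ^ 2 = algebraMap (ZMod p) K b * ξ + algebraMap (ZMod p) K c) :
    ξ ^ p = algebraMap (ZMod p) K b - ξ := by
  have : CharP K p := charP_of_injective_algebraMap (algebraMap (ZMod p) K).injective p
  have hodd : p % 2 = 1 := (Fact.out : p.Prime).eq_two_or_odd.resolve_left hp
  have h2 : (2 : K) ≠ 0 := by
    intro h
    have : ((2 : ℕ) : K) = 0 := by exact_mod_cast h
    rw [CharP.cast_eq_zero_iff K p] at this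
    have := (Nat.prime_dvd_prime_iff_eq Fact.out Nat.prime_two).1 this
    exact hp this
  have hD0 : b ^ 2 + 4 * c ≠ 0 := by
    intro h; rw [h] at hD; exact hD IsSquare.zero
  have hDp : (b ^ 2 + 4 * c) ^ (p / 2) = -1 := by
    rcases ZMod.pow_div_two_eq_neg_one_or_one p hD0 with h | h
    · exact absurd ((ZMod.euler_criterion p hD0).2 h) hD
    · exact h
  have hd2 : (2 * ξ - algebraMap (ZMod p) K b) ^ 2 = algebraMap (ZMod p) K (b ^ 2 + 4 * c) := by
    simp only [map_add, map_mul, map_pow, map_ofNat]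
    linear_combination 4 * hξ
  -- Frobenius negates a square root of a nonresidue, by Euler's criterion.
  have hdp : (2 * ξ - algebraMap (ZMod p) K b) ^ p = -(2 * ξ - algebraMap (ZMod p) K b) := by
    have : ∀ d : K, d ^ p = (d ^ 2) ^ (p / 2) * d := fun d => by
      rw [← pow_mul, ← pow_succ]; congr 1; omega
    rw [this, hd2, ← map_pow, hDp]; simp
  rw [sub_pow_char, mul_pow, ← map_pow, ZMod.pow_card] at hdp
  have h2p : (2 : K) ^ p = 2 := by
    have := congrArg (algebraMap (ZMod p) K) (ZMod.pow_card (2 : ZMod p))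
    rwa [map_pow, map_ofNat] at this
  rw [h2p] at hdp
  apply mul_left_cancel₀ h2
  linear_combination hdp

/-- Residues `(b, c)` modulo `p` for which `x² - b x - c` is irreducible, `-c` is a square and all
roots `ξ` satisfy `ξ ^ E = y`. -/
def inertPairs (p E : ℕ) (y : ℤ) : Set (ZMod p × ZMod p) :=
  {q | ¬ IsSquare (q.1 ^ 2 + 4 * q.2) ∧ IsSquare (-q.2) ∧
    ∀ (K : Type) [Field K] [Algebra (ZMod p) K] (ξ : K),
      ξ ^ 2 = algebraMap (ZMod p) K q.1 * ξ + algebraMap (ZMod p) K q.2 → ξ ^ E = y}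

/-- The norm `ξ^(p+1) = -c` is a nonzero square in `F_p`, so its power `(p-1)/2` is `1`. -/
theorem root_pow_half {p : ℕ} [Fact p.Prime] (hp : p ≠ 2) {K : Type*} [Field K]
    [Algebra (ZMod p) K] {b c : ZMod p} (hD : ¬ IsSquare (b ^ 2 + 4 * c)) (hc : IsSquare (-c)) {ξ : K}
    (hξ : ξ ^ 2 = algebraMap (ZMod p) K b * ξ + algebraMap (ZMod p) K c) :
    ξ ^ ((p ^ 2 - 1) / 2) = 1 := by
  have hodd : p % 2 = 1 := (Fact.out : p.Prime).eq_two_or_odd.resolve_left hp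
  have hc0 : -c ≠ 0 := by
    intro h
    apply hD
    rw [neg_eq_zero.1 h]
    exact ⟨b, by ring⟩
  have h1 : ξ ^ (p + 1) = algebraMap (ZMod p) K (-c) := by
    rw [pow_succ, frobenius_root hp hD hξ, map_neg]
    linear_combination -hξ
  have h2 : (p ^ 2 - 1) / 2 = (p + 1) * (p / 2) := by
    obtain ⟨t, ht⟩ : ∃ t, p = 2 * t + 1 := ⟨p / 2, by omega⟩
    have h3 : p / 2 = t := by omega
    have h4 : p ^ 2 - 1 = 2 * ((2 * t + 2) * t) := by
      rw [ht]; have : (2 * t + 1) ^ 2 = 2 * ((2 * t + 2) * t) + 1 := by ring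
      omega
    rw [h3, h4, ht, Nat.mul_div_cancel_left _ (by norm_num)]
  rw [h2, pow_mul, h1, ← map_pow, (ZMod.euler_criterion p hc0).1 hc, map_one]

/-- Every element of `F_p` is a square in `F_{p^2}`, as `p - 1` divides `(p^2-1)/2`. -/
theorem exists_root_galoisField {p : ℕ} [Fact p.Prime] (hp : p ≠ 2) (b c : ZMod p) :
    ∃ ξ : GaloisField p 2,
      ξ ^ 2 = algebraMap (ZMod p) (GaloisField p 2) b * ξ + algebraMap (ZMod p) (GaloisField p 2) c := by
  classical
  have hodd : p % 2 = 1 := (Fact.out : p.Prime).eq_two_or_odd.resolve_left hp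
  let K := GaloisField p 2
  have : Fintype K := Fintype.ofFinite K
  have h2 : (2 : K) ≠ 0 := by
    intro h
    have : ((2 : ℕ) : K) = 0 := by exact_mod_cast h
    rw [CharP.cast_eq_zero_iff K p] at this
    exact hp ((Nat.prime_dvd_prime_iff_eq Fact.out Nat.prime_two).1 this)
  have hsq : IsSquare (algebraMap (ZMod p) K (b ^ 2 + 4 * c)) := by
    by_cases h0 : b ^ 2 + 4 * c = 0
    · rw [h0, map_zero]; exact IsSquare.zero
    · rw [FiniteField.isSquare_iff (by rw [ringChar.eq K p]; exact hp) ((map_ne_zero _).2 h0)]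
      have hcard : Fintype.card K = p ^ 2 := by
        rw [← Nat.card_eq_fintype_card]; exact GaloisField.card p 2 (by norm_num)
      have h4 : p ^ 2 / 2 = (p - 1) * ((p + 1) / 2) := by
        obtain ⟨t, ht⟩ : ∃ t, p = 2 * t + 1 := ⟨p / 2, by omega⟩
        have h5 : (p + 1) / 2 = t + 1 := by omega
        have h6 : p - 1 = 2 * t := by omega
        have : p ^ 2 = 2 * (2 * t * (t + 1)) + 1 := by rw [ht]; ring
        rw [h5, h6, this]; omega
      rw [hcard, h4, pow_mul, ← map_pow, ZMod.pow_card_sub_one_eq_one h0]; simp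
  obtain ⟨d, hd⟩ := hsq
  refine ⟨(algebraMap (ZMod p) K b + d) / 2, ?_⟩
  simp only [map_add, map_mul, map_pow, map_ofNat] at hd
  field_simp
  linear_combination -hd

/-- Double counting in `F_{p^2}`: each pair has two distinct roots `ξ` and `b - ξ`, and a root
outside `F_p` determines its pair. -/
theorem two_mul_ncard_inertPairs_le {p : ℕ} [Fact p.Prime] (hp : p ≠ 2) (E : ℕ) {y : ℤ}
    (hy : y = 1 ∨ y = -1) :
    2 * (inertPairs p E y).ncard ≤ ((p ^ 2 - 1) / 2).gcd E := by
  classical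
  have hp3 : 3 ≤ p := by
    have := (Fact.out : p.Prime).two_le
    omega
  let K := GaloisField p 2
  have : Fintype K := Fintype.ofFinite K
  have h2 : (2 : K) ≠ 0 := by
    intro h
    have : ((2 : ℕ) : K) = 0 := by exact_mod_cast h
    rw [CharP.cast_eq_zero_iff K p] at this
    exact hp ((Nat.prime_dvd_prime_iff_eq Fact.out Nat.prime_two).1 this)
  have hyK : (y : K) ≠ 0 := by rcases hy with rfl | rfl <;> simp
  have ha : 0 < (p ^ 2 - 1) / 2 := by
    have : 3 ^ 2 ≤ p ^ 2 := Nat.pow_le_pow_left hp3 2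
    omega
  refine le_trans ?_ (card_pow_eq_le ((p ^ 2 - 1) / 2) E ha (y : K) hyK)
  rw [Set.ncard_eq_toFinset_card']
  have key := Finset.card_mul_le_card_mul
    (fun (q : ZMod p × ZMod p) (ξ : K) =>
      ξ ^ 2 = algebraMap (ZMod p) K q.1 * ξ + algebraMap (ZMod p) K q.2)
    (s := (inertPairs p E y).toFinset)
    (t := Finset.univ.filter (fun ξ : K => ξ ^ ((p ^ 2 - 1) / 2) = 1 ∧ ξ ^ E = (y : K)))
    (m := 2) (n := 1) ?_ ?_
  · omega
  · intro q hq
    rw [Set.mem_toFinset] at hq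
    obtain ⟨hD, hc, hE⟩ := hq
    obtain ⟨ξ, hξ⟩ := exists_root_galoisField hp q.1 q.2
    have hη : (algebraMap (ZMod p) K q.1 - ξ) ^ 2 =
        algebraMap (ZMod p) K q.1 * (algebraMap (ZMod p) K q.1 - ξ) + algebraMap (ZMod p) K q.2 := by
      linear_combination hξ
    have hne : ξ ≠ algebraMap (ZMod p) K q.1 - ξ := by
      intro h
      apply hD
      have h0 : algebraMap (ZMod p) K (q.1 ^ 2 + 4 * q.2) = 0 := by
        simp only [map_add, map_mul, map_pow, map_ofNat]
        linear_combination -4 * hξ + (2 * ξ - algebraMap (ZMod p) K q.1) * h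
      rw [map_eq_zero] at h0
      rw [h0]; exact IsSquare.zero
    refine (Finset.card_pair hne).symm.le.trans (Finset.card_le_card ?_)
    intro z hz
    have hz' : z ^ 2 = algebraMap (ZMod p) K q.1 * z + algebraMap (ZMod p) K q.2 := by
      rcases Finset.mem_insert.1 hz with rfl | hz
      · exact hξ
      · rw [Finset.mem_singleton.1 hz]; exact hη
    rw [Finset.mem_bipartiteAbove]
    refine ⟨?_, hz'⟩
    simp only [Finset.mem_filter, Finset.mem_univ, true_and]
    exact ⟨root_pow_half hp hD hc hz', hE K z hz'⟩
  · intro ξ _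
    rw [Finset.card_le_one]
    rintro ⟨b, c⟩ h ⟨b', c'⟩ h'
    rw [Finset.mem_bipartiteBelow, Set.mem_toFinset] at h h'
    obtain ⟨⟨hD, -, -⟩, hξ⟩ := h
    obtain ⟨-, hξ'⟩ := h'
    simp only at hD hξ hξ'
    have hlin : algebraMap (ZMod p) K (b - b') * ξ = algebraMap (ZMod p) K (c' - c) := by
      simp only [map_sub]; linear_combination hξ' - hξ
    have hb : b - b' = 0 := by
      by_contra hb
      have hbK : algebraMap (ZMod p) K (b - b') ≠ 0 := (map_ne_zero _).2 hb
      have hξe : ξ = algebraMap (ZMod p) K ((c' - c) / (b - b')) := by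
        rw [map_div₀, eq_div_iff hbK]; linear_combination hlin
      rw [hξe, ← map_pow, ← map_mul, ← map_add] at hξ
      have h5 := (algebraMap (ZMod p) K).injective hξ
      generalize (c' - c) / (b - b') = w at h5
      exact hD ⟨2 * w - b, by linear_combination -4 * h5⟩
    rw [hb, map_zero, zero_mul] at hlin
    have hc : c' - c = 0 := (map_eq_zero (algebraMap (ZMod p) K)).1 hlin.symm
    rw [sub_eq_zero] at hb hc
    rw [hb, hc]

/-- Write `(p^2-1)/2 = 2^i o` with `o` odd. If `i ≤ j`, then `ξ^(2^j s)` raised to `o` is both `1`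
and `(-1)^o = -1`. So `j < i`, and the halving supplies one more factor `2`. -/
theorem two_pow_dvd_of_inertPairs_nonempty {p : ℕ} [Fact p.Prime] (hp : p ≠ 2) {j s : ℕ}
    (h : (inertPairs p (2 ^ j * s) (-1)).Nonempty) : 2 ^ (j + 2) ∣ p ^ 2 - 1 := by
  obtain ⟨q, hD, hc, hE⟩ := h
  have hp3 : 3 ≤ p := by
    have := (Fact.out : p.Prime).two_le
    omega
  obtain ⟨ξ, hξ⟩ := exists_root_galoisField hp q.1 q.2
  have h1 := root_pow_half hp hD hc hξ
  have h2 := hE _ ξ hξ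
  have h9 : 3 ^ 2 ≤ p ^ 2 := Nat.pow_le_pow_left hp3 2
  have hodd : p % 2 = 1 := (Fact.out : p.Prime).eq_two_or_odd.resolve_left hp
  have hev : 2 * ((p ^ 2 - 1) / 2) = p ^ 2 - 1 := by
    have : p ^ 2 % 2 = 1 := by rw [Nat.pow_mod, hodd]
    omega
  obtain ⟨i, o, ho, hio⟩ := Nat.exists_eq_two_pow_mul_odd (n := (p ^ 2 - 1) / 2) (by omega)
  by_cases hij : j + 1 ≤ i
  · rw [← hev, hio]
    obtain ⟨t, rfl⟩ := Nat.exists_eq_add_of_le hij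
    exact ⟨2 ^ t * o, by ring⟩
  · exfalso
    obtain ⟨t, rfl⟩ : ∃ t, j = i + t := Nat.exists_eq_add_of_le (by omega)
    have h3 : (ξ ^ (2 ^ (i + t) * s)) ^ o = 1 := by
      rw [← pow_mul, show 2 ^ (i + t) * s * o = (2 ^ i * o) * (2 ^ t * s) by ring, pow_mul, ← hio, h1,
        one_pow]
    rw [h2] at h3
    simp only [Int.cast_neg, Int.cast_one] at h3
    rw [ho.neg_one_pow] at h3
    have h4 : ((2 : ℕ) : GaloisField p 2) = 0 := by
      push_cast; linear_combination -h3
    rw [CharP.cast_eq_zero_iff (GaloisField p 2) p] at h4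
    exact hp ((Nat.prime_dvd_prime_iff_eq Fact.out Nat.prime_two).1 h4)

/-! ### Counting passing pairs for squarefree `n`, prime by prime -/

theorem ncard_le_prod_of_squarefree {n : ℕ} (hn : Squarefree n) {A : Set (ℕ × ℕ)}
    (hA : ∀ q ∈ A, q.1 < n ∧ q.2 < n) (Q : ∀ p : ℕ, Set (ZMod p × ZMod p))
    (hQ : ∀ q ∈ A, ∀ p ∈ n.primeFactors, ((q.1 : ZMod p), (q.2 : ZMod p)) ∈ Q p) :
    A.ncard ≤ ∏ p ∈ n.primeFactors, (Q p).ncard := by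
  let f : A → ∀ p : n.primeFactors, Q p := fun q p => ⟨_, hQ q.1 q.2 p.1 p.2⟩
  have hfin : ∀ p : n.primeFactors, Finite (Q p) := by
    intro p
    have : NeZero p.1 := ⟨(Nat.prime_of_mem_primeFactors p.2).ne_zero⟩
    infer_instance
  have hmod : ∀ a b : ℕ, (∀ p ∈ n.primeFactors, (a : ZMod p) = (b : ZMod p)) →
      a < n → b < n → a = b := by
    intro a b hab ha hb
    refine Nat.ModEq.eq_of_lt_of_lt ?_ ha hb
    rw [Nat.modEq_iff_dvd, ← Nat.prod_primeFactors_of_squarefree hn, Nat.cast_prod]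
    refine Finset.prod_dvd_of_coprime ?_ ?_
    · intro p hp q hq hpq
      exact Nat.isCoprime_iff_coprime.2 ((Nat.coprime_primes (Nat.prime_of_mem_primeFactors hp)
        (Nat.prime_of_mem_primeFactors hq)).2 hpq)
    · intro p hp
      have := hab p hp
      rwa [ZMod.natCast_eq_natCast_iff, Nat.modEq_iff_dvd] at this
  have hf : Function.Injective f := by
    intro q q' h
    have h' : ∀ p ∈ n.primeFactors, (q.1.1 : ZMod p) = q'.1.1 ∧ (q.1.2 : ZMod p) = q'.1.2 := by
      intro p hp
      have := congrArg Subtype.val (congrFun h ⟨p, hp⟩)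
      exact Prod.mk.inj this
    apply Subtype.ext
    exact Prod.ext
      (hmod _ _ (fun p hp => (h' p hp).1) (hA _ q.2).1 (hA _ q'.2).1)
      (hmod _ _ (fun p hp => (h' p hp).2) (hA _ q.2).2 (hA _ q'.2).2)
  have := Nat.card_le_card_of_injective f hf
  rw [Nat.card_pi] at this
  refine this.trans_eq ?_
  exact Finset.prod_coe_sort n.primeFactors (fun p => Nat.card (Q p))

/-- Residues `(b, c)` modulo `p` for which `x² - b x - c` has roots `u` and `u ^ n`. -/
def splitPairs (p n : ℕ) : Set (ZMod p × ZMod p) :=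
  Set.range (fun u : ZMod p => (u + u ^ n, -(u * u ^ n)))

theorem ncard_splitPairs_le (p n : ℕ) [NeZero p] : (splitPairs p n).ncard ≤ p := by
  unfold splitPairs
  rw [← Set.image_univ]
  refine (Set.ncard_image_le).trans ?_
  rw [Set.ncard_univ, Nat.card_zmod]

theorem PassesQFT.cast_ne_zero {B n : ℕ} (hn : n ≠ 0) {b c : ℤ} (h : PassesQFT B n b c) {p : ℕ}
    (hp : p.Prime) (hpn : p ∣ n) :
    (c : ZMod p) ≠ 0 ∧ (b : ZMod p) ^ 2 + 4 * (c : ZMod p) ≠ 0 := by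
  have : NeZero n := ⟨hn⟩
  have key : ∀ a : ℤ, jacobiSym a n ≠ 0 → (a : ZMod p) ≠ 0 := by
    intro a ha h0
    apply ha
    rw [jacobiSym.eq_zero_iff_not_coprime]
    intro hg
    rw [ZMod.intCast_zmod_eq_zero_iff_dvd] at h0
    have := Int.dvd_gcd h0 (Int.natCast_dvd_natCast.2 hpn)
    rw [hg] at this
    exact hp.one_lt.ne' (Nat.dvd_one.1 (by exact_mod_cast this))
  constructor
  · have := key (-c) (by rw [h.params.2]; norm_num)
    simpa using this
  · have := key _ (by rw [h.params.1]; norm_num)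
    simpa using this

/-- For a root `u` in `F_p`, step 4 gives `u^(n+1) = -c = u(b - u)`, so the other root is `u^n`. -/
theorem PassesQFT.mem_splitPairs {B n : ℕ} (hn : n ≠ 0) {b c : ℤ} (h : PassesQFT B n b c) {p : ℕ}
    [Fact p.Prime] (hp2 : p ≠ 2) (hpn : p ∣ n)
    (hD : IsSquare ((b : ZMod p) ^ 2 + 4 * (c : ZMod p))) :
    ((b : ZMod p), (c : ZMod p)) ∈ splitPairs p n := by
  obtain ⟨d, hd⟩ := hD
  have hc := (h.cast_ne_zero hn Fact.out hpn).1
  have h2 : (2 : ZMod p) ≠ 0 := by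
    intro h
    have : ((2 : ℕ) : ZMod p) = 0 := by exact_mod_cast h
    rw [ZMod.natCast_eq_zero_iff] at this
    exact hp2 ((Nat.prime_dvd_prime_iff_eq Fact.out Nat.prime_two).1 this)
  obtain ⟨u, hu⟩ : ∃ u, u = ((b : ZMod p) + d) / 2 := ⟨_, rfl⟩
  have hu2 : 2 * u = b + d := by rw [hu]; field_simp
  have huv : u * (b - u) = -(c : ZMod p) := by
    apply mul_left_cancel₀ (mul_ne_zero h2 h2)
    linear_combination (b - 2 * u - d) * hu2 + hd
  have hroot : u ^ 2 = (b : ZMod p) * u + (c : ZMod p) := by linear_combination -huv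
  have hpow := (h.root_pow_eq (ZMod.castHom hpn (ZMod p)) hroot).2.1
  have hu0 : u ≠ 0 := by
    rintro h0; rw [h0, zero_mul] at huv; exact hc (neg_eq_zero.1 huv.symm)
  have hun : u ^ n = b - u := by
    apply mul_left_cancel₀ hu0
    rw [huv, ← hpow]; ring
  refine ⟨u, ?_⟩
  simp only [hun, huv]
  simp

/-- Step 3 makes `x^((n+1)/2)` a scalar, and by step 4 its square is `-c`. -/
theorem PassesQFT.isSquare_neg {B n : ℕ} (hodd : Odd n) {b c : ℤ} (h : PassesQFT B n b c) {p : ℕ}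
    [Fact p.Prime] (hp2 : p ≠ 2) (hpn : p ∣ n) : IsSquare (-(c : ZMod p)) := by
  obtain ⟨ξ, hξ⟩ := exists_root_galoisField hp2 (b : ZMod p) (c : ZMod p)
  rw [map_intCast, map_intCast] at hξ
  obtain ⟨⟨a, ha⟩, hpow, -⟩ := h.root_pow_eq
    ((algebraMap (ZMod p) (GaloisField p 2)).comp (ZMod.castHom hpn (ZMod p))) hξ
  have hn : n + 1 = (n + 1) / 2 + (n + 1) / 2 := by obtain ⟨t, rfl⟩ := hodd; omega
  rw [hn, pow_add, ha, RingHom.comp_apply, ← map_mul] at hpow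
  refine ⟨ZMod.castHom hpn (ZMod p) a, (algebraMap (ZMod p) (GaloisField p 2)).injective ?_⟩
  rw [hpow, map_neg, map_intCast]

theorem PassesQFT.mem_inertPairs {B n : ℕ} (hodd : Odd n) {b c : ℤ} (h : PassesQFT B n b c)
    {E : ℕ} {y : ℤ} (hE : qftX n b c ^ E = y) {p : ℕ}
    [Fact p.Prime] (hp2 : p ≠ 2) (hpn : p ∣ n)
    (hD : ¬ IsSquare ((b : ZMod p) ^ 2 + 4 * (c : ZMod p))) :
    ((b : ZMod p), (c : ZMod p)) ∈ inertPairs p E y := by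
  refine ⟨hD, h.isSquare_neg hodd hp2 hpn, ?_⟩
  intro K _ _ ξ hξ
  simp only [map_intCast] at hξ
  obtain ⟨ψ, hx, -⟩ := exists_qftRing_hom
    ((algebraMap (ZMod p) K).comp (ZMod.castHom hpn (ZMod p))) hξ
  rw [← hx, ← map_pow, hE, map_intCast]

/-- The passing pairs among the standard residues. -/
def passPairs (B n : ℕ) : Set (ℕ × ℕ) :=
  {q | q.1 < n ∧ q.2 < n ∧ PassesQFT B n (q.1 : ℤ) (q.2 : ℤ)}

theorem finite_of_lt {n : ℕ} {A : Set (ℕ × ℕ)} (hA : ∀ q ∈ A, q.1 < n ∧ q.2 < n) : A.Finite :=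
  ((Set.finite_lt_nat n).prod (Set.finite_lt_nat n)).subset fun q hq => hA q hq

/-- Pairs whose residues modulo every prime divisor of `n` lie in `inertPairs`. -/
def inertEverywhere (n E : ℕ) (y : ℤ) : Set (ℕ × ℕ) :=
  {q | q.1 < n ∧ q.2 < n ∧ ∀ p ∈ n.primeFactors, ((q.1 : ZMod p), (q.2 : ZMod p)) ∈ inertPairs p E y}

theorem two_pow_mul_ncard_inertEverywhere_le {n : ℕ} (hodd : Odd n) (hsq : Squarefree n) (E : ℕ)
    {y : ℤ} (hy : y = 1 ∨ y = -1) :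
    2 ^ n.primeFactors.card * (inertEverywhere n E y).ncard ≤
      ∏ p ∈ n.primeFactors, ((p ^ 2 - 1) / 2).gcd E := by
  refine (Nat.mul_le_mul_left _ (ncard_le_prod_of_squarefree hsq (fun q hq => ⟨hq.1, hq.2.1⟩)
    (fun p => inertPairs p E y) (fun q hq => hq.2.2))).trans ?_
  rw [← Finset.prod_const, ← Finset.prod_mul_distrib]
  refine Finset.prod_le_prod' fun p hp => ?_
  have : Fact p.Prime := ⟨Nat.prime_of_mem_primeFactors hp⟩
  have hp2 : p ≠ 2 := by
    rintro rfl
    exact (Nat.not_even_iff_odd.2 hodd) (even_iff_two_dvd.2 (Nat.dvd_of_mem_primeFactors hp))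
  exact two_mul_ncard_inertPairs_le hp2 E hy

/-- The passing pairs for which `x² - b x - c` is irreducible modulo every prime divisor of `n`. -/
def inertPassPairs (B n : ℕ) : Set (ℕ × ℕ) :=
  {q ∈ passPairs B n | ∀ p ∈ n.primeFactors, ¬ IsSquare ((q.1 : ZMod p) ^ 2 + 4 * (q.2 : ZMod p))}

theorem two_pow_mul_ncard_inertPassPairs_le {n B r s J : ℕ} (hodd : Odd n)
    (hsq : Squarefree n) (hs : Odd s) (hrs : n ^ 2 - 1 = 2 ^ r * s)
    (hJ : ∀ j : ℕ, (∀ p ∈ n.primeFactors, 2 ^ (j + 1) ∣ p ^ 2 - 1) → j ≤ J) :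
    2 ^ n.primeFactors.card * (inertPassPairs B n).ncard ≤
      (∏ p ∈ n.primeFactors, (p ^ 2 - 1).gcd s) *
        (1 + ∑ j ∈ Finset.range J, (2 ^ n.primeFactors.card) ^ j) := by
  have hp2 : ∀ p ∈ n.primeFactors, p ≠ 2 := by
    rintro p hp rfl
    exact (Nat.not_even_iff_odd.2 hodd) (even_iff_two_dvd.2 (Nat.dvd_of_mem_primeFactors hp))
  have hfin : ∀ E y, (inertEverywhere n E y).Finite :=
    fun E y => finite_of_lt (n := n) fun q hq => ⟨hq.1, hq.2.1⟩
  have hsub : inertPassPairs B n ⊆ inertEverywhere n s 1 ∪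
      ⋃ j ∈ Finset.range J, inertEverywhere n (2 ^ j * s) (-1) := by
    rintro q ⟨⟨hq1, hq2, hq⟩, hD⟩
    have hmem : ∀ (E : ℕ) (y : ℤ), qftX n (q.1 : ℤ) (q.2 : ℤ) ^ E = y → q ∈ inertEverywhere n E y := by
      intro E y hE
      refine ⟨hq1, hq2, fun p hp => ?_⟩
      have : Fact p.Prime := ⟨Nat.prime_of_mem_primeFactors hp⟩
      have := hq.mem_inertPairs hodd hE (hp2 p hp) (Nat.dvd_of_mem_primeFactors hp)
        (by simpa using hD p hp)
      simpa using this
    rcases hq.step5_of_decomposition hs hrs with h | ⟨j, -, h⟩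
    · exact Or.inl (hmem s 1 (by simpa using h))
    · right
      have hm := hmem (2 ^ j * s) (-1) (by simpa using h)
      simp only [Set.mem_iUnion, Finset.mem_range]
      refine ⟨j, ?_, hm⟩
      -- The divisibility is by `2^(j+2)`, so `j + 1 ≤ J`: the sum stops at `J - 1`.
      refine hJ (j + 1) fun p hp => ?_
      have : Fact p.Prime := ⟨Nat.prime_of_mem_primeFactors hp⟩
      exact two_pow_dvd_of_inertPairs_nonempty (hp2 p hp) ⟨_, hm.2.2 p hp⟩
  have hcard : (inertPassPairs B n).ncard ≤ (inertEverywhere n s 1).ncard +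
      ∑ j ∈ Finset.range J, (inertEverywhere n (2 ^ j * s) (-1)).ncard := by
    refine (Set.ncard_le_ncard hsub ((hfin _ _).union
      ((Finset.range J).finite_toSet.biUnion fun j _ => hfin _ _))).trans ?_
    refine (Set.ncard_union_le _ _).trans (Nat.add_le_add_left ?_ _)
    exact Finset.set_ncard_biUnion_le _ _
  have hgcd : ∀ (p j : ℕ), p ∈ n.primeFactors →
      ((p ^ 2 - 1) / 2).gcd (2 ^ j * s) ≤ 2 ^ j * (p ^ 2 - 1).gcd s := by
    intro p j hp
    have hev : (p ^ 2 - 1) / 2 ∣ p ^ 2 - 1 := by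
      have hpo : p % 2 = 1 := (Nat.prime_of_mem_primeFactors hp).eq_two_or_odd.resolve_left (hp2 p hp)
      have : p ^ 2 % 2 = 1 := by rw [Nat.pow_mod, hpo]
      exact ⟨2, by omega⟩
    have hspos : 0 < s := hs.pos
    apply Nat.le_of_dvd (Nat.mul_pos (by positivity) (Nat.gcd_pos_of_pos_right _ hspos))
    refine (Nat.gcd_dvd_gcd_of_dvd_left _ hev).trans ?_
    exact (Nat.gcd_mul_right_dvd_mul_gcd _ _ _).trans (Nat.mul_dvd_mul_right (Nat.gcd_dvd_right _ _) _)
  have hone : 2 ^ n.primeFactors.card * (inertEverywhere n s 1).ncard ≤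
      ∏ p ∈ n.primeFactors, (p ^ 2 - 1).gcd s := by
    refine (two_pow_mul_ncard_inertEverywhere_le hodd hsq s (Or.inl rfl)).trans ?_
    exact Finset.prod_le_prod' fun p hp => by simpa using hgcd p 0 hp
  have hneg : ∀ j, 2 ^ n.primeFactors.card * (inertEverywhere n (2 ^ j * s) (-1)).ncard ≤
      (∏ p ∈ n.primeFactors, (p ^ 2 - 1).gcd s) * (2 ^ n.primeFactors.card) ^ j := by
    intro j
    refine (two_pow_mul_ncard_inertEverywhere_le hodd hsq _ (Or.inr rfl)).trans ?_
    refine (Finset.prod_le_prod' fun p hp => hgcd p j hp).trans_eq ?_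
    rw [Finset.prod_mul_distrib, Finset.prod_const, ← pow_mul, ← pow_mul, mul_comm j, mul_comm]
  calc _ ≤ _ := Nat.mul_le_mul_left _ hcard
    _ ≤ _ := by
      rw [mul_add, mul_add, Finset.mul_sum, Finset.mul_sum, mul_one]
      exact Nat.add_le_add hone (Finset.sum_le_sum fun j _ => hneg j)

/-- The passing pairs with a root modulo the prime `l`. -/
theorem ncard_splitPassPairs_le {n B l : ℕ} (hodd : Odd n) (h1 : 1 < n) (hsq : Squarefree n)
    (hl : l ∈ n.primeFactors) (hB : 50000 ≤ B) (hbig : ∀ p ∈ n.primeFactors, B < p) :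
    (({q ∈ passPairs B n | IsSquare ((q.1 : ZMod l) ^ 2 + 4 * (q.2 : ZMod l))}.ncard : ℕ) : ℝ) ≤
      (n : ℝ) ^ 2 * ((3 / 10) ^ (n.primeFactors.card - 1) / B) := by
  have hp2 : ∀ p ∈ n.primeFactors, p ≠ 2 := fun p hp => by have := hbig p hp; omega
  -- Exponent `0` and value `1` make the power condition vacuous: only the bound `(p^2-1)/4` on
  -- inert pairs remains. The constant `3/10` also absorbs the `p` split pairs.
  let Q : ∀ p : ℕ, Set (ZMod p × ZMod p) := fun p =>
    if p = l then splitPairs p n else splitPairs p n ∪ inertPairs p 0 1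
  have hle := ncard_le_prod_of_squarefree hsq
    (A := {q ∈ passPairs B n | IsSquare ((q.1 : ZMod l) ^ 2 + 4 * (q.2 : ZMod l))})
    (fun q hq => ⟨hq.1.1, hq.1.2.1⟩) Q (by
      rintro q ⟨⟨-, -, hq⟩, hD⟩ p hp
      have : Fact p.Prime := ⟨Nat.prime_of_mem_primeFactors hp⟩
      have hpn := Nat.dvd_of_mem_primeFactors hp
      by_cases hpl : p = l
      · subst hpl
        have := hq.mem_splitPairs (by omega) (hp2 p hp) hpn (by simpa using hD)
        simpa [Q] using this
      · simp only [Q, if_neg hpl]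
        by_cases hDp : IsSquare ((q.1 : ZMod p) ^ 2 + 4 * (q.2 : ZMod p))
        · left
          have := hq.mem_splitPairs (by omega) (hp2 p hp) hpn (by simpa using hDp)
          simpa using this
        · right
          have := hq.mem_inertPairs hodd (E := 0) (y := 1) (by simp) (hp2 p hp) hpn
            (by simpa using hDp)
          simpa using this)
  have hBpos : (0 : ℝ) < B := by exact_mod_cast (by omega : 0 < B)
  have hw : ∀ p ∈ n.primeFactors,
      ((Q p).ncard : ℝ) ≤ (p : ℝ) ^ 2 * (if p = l then 1 / (B : ℝ) else 3 / 10) := by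
    intro p hp
    have : Fact p.Prime := ⟨Nat.prime_of_mem_primeFactors hp⟩
    have hBp : (B : ℝ) < p := by exact_mod_cast hbig p hp
    have hB' : (50000 : ℝ) ≤ B := by exact_mod_cast hB
    have hs : ((splitPairs p n).ncard : ℝ) ≤ p := by exact_mod_cast ncard_splitPairs_le p n
    by_cases hpl : p = l
    · simp only [Q, if_pos hpl]
      refine hs.trans ?_
      rw [mul_one_div, le_div_iff₀ hBpos]
      nlinarith
    · simp only [Q, if_neg hpl]
      have hi := two_mul_ncard_inertPairs_le (p := p) (hp2 p hp) 0 (y := 1) (Or.inl rfl)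
      rw [Nat.gcd_zero_right] at hi
      have hi' : 4 * (inertPairs p 0 1).ncard ≤ p ^ 2 := by omega
      have hi'' : 4 * ((inertPairs p 0 1).ncard : ℝ) ≤ (p : ℝ) ^ 2 := by exact_mod_cast hi'
      have hu : (((splitPairs p n ∪ inertPairs p 0 1).ncard : ℕ) : ℝ) ≤
          (splitPairs p n).ncard + (inertPairs p 0 1).ncard := by
        exact_mod_cast Set.ncard_union_le _ _
      nlinarith
  calc _ ≤ ((∏ p ∈ n.primeFactors, (Q p).ncard : ℕ) : ℝ) := by exact_mod_cast hle
    _ ≤ ∏ p ∈ n.primeFactors, ((p : ℝ) ^ 2 * (if p = l then 1 / (B : ℝ) else 3 / 10)) := by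
      rw [Nat.cast_prod]
      exact Finset.prod_le_prod (fun _ _ => by positivity) hw
    _ = _ := by
      rw [Finset.prod_mul_distrib, Finset.prod_pow, ← Nat.cast_prod,
        Nat.prod_primeFactors_of_squarefree hsq, ← Finset.mul_prod_erase _ _ hl, if_pos rfl]
      rw [Finset.prod_congr rfl (g := fun _ => (3 / 10 : ℝ))
        (fun p hp => if_neg (Finset.ne_of_mem_erase hp)), Finset.prod_const,
        Finset.card_erase_of_mem hl]
      ring

/-! ### Character sums and the lower bound for `M(n)` -/

theorem sum_range_eq_sum_zmod {n : ℕ} [NeZero n] (F : ZMod n → ℤ) :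
    ∑ i ∈ Finset.range n, F (i : ZMod n) = ∑ x : ZMod n, F x := by
  refine Finset.sum_bij' (fun i _ => (i : ZMod n)) (fun x _ => x.val) ?_ ?_ ?_ ?_ ?_
  · intro i _; exact Finset.mem_univ _
  · intro x _; exact Finset.mem_range.2 (ZMod.val_lt x)
  · intro i hi; exact ZMod.val_cast_of_lt (Finset.mem_range.1 hi)
  · intro x _; exact ZMod.natCast_zmod_val x
  · intro i _; rfl

theorem sum_range_mul_of_coprime {p m : ℕ} [NeZero p] [NeZero m] (h : p.Coprime m)
    (G : ZMod p → ZMod m → ℤ) :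
    ∑ i ∈ Finset.range (p * m), G (i : ZMod p) (i : ZMod m) = ∑ x, ∑ y, G x y := by
  have h1 := sum_range_eq_sum_zmod (n := p * m)
    (fun z => G (ZMod.chineseRemainder h z).1 (ZMod.chineseRemainder h z).2)
  simp only [map_natCast, Prod.fst_natCast, Prod.snd_natCast] at h1
  rw [h1, ← Fintype.sum_prod_type' (f := G)]
  exact Equiv.sum_comp (ZMod.chineseRemainder h).toEquiv (fun z => G z.1 z.2)

/-- The double sum factors by the Chinese remainder theorem, so cancellation at a single prime
suffices and the cofactor is arbitrary. -/
theorem sum_range_sum_range_eq_zero {p m : ℕ} [NeZero p] [NeZero m] (h : p.Coprime m)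
    (g : ZMod p → ZMod p → ℤ) (k : ZMod m → ZMod m → ℤ) (hg : ∑ x, ∑ y, g x y = 0) :
    ∑ b ∈ Finset.range (p * m), ∑ c ∈ Finset.range (p * m),
      g (b : ZMod p) (c : ZMod p) * k (b : ZMod m) (c : ZMod m) = 0 := by
  have h1 : ∀ b : ℕ, ∑ c ∈ Finset.range (p * m),
      g (b : ZMod p) (c : ZMod p) * k (b : ZMod m) (c : ZMod m) =
      (∑ y, g (b : ZMod p) y) * ∑ y, k (b : ZMod m) y := by
    intro b
    rw [sum_range_mul_of_coprime h (fun x y => g (b : ZMod p) x * k (b : ZMod m) y),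
      Finset.sum_mul_sum]
  rw [Finset.sum_congr rfl fun b _ => h1 b,
    sum_range_mul_of_coprime h (fun x x' => (∑ y, g x y) * ∑ y, k x' y), ← Finset.sum_mul_sum, hg,
    zero_mul]

section CharacterSums

variable {p : ℕ} [Fact p.Prime]

theorem zmod_two_ne_zero (hp : p ≠ 2) : (2 : ZMod p) ≠ 0 := by
  intro h
  have : ((2 : ℕ) : ZMod p) = 0 := by exact_mod_cast h
  rw [ZMod.natCast_eq_zero_iff] at this
  exact hp ((Nat.prime_dvd_prime_iff_eq Fact.out Nat.prime_two).1 this)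

theorem quadraticChar_zmod_ne_one (hp : p ≠ 2) : quadraticChar (ZMod p) ≠ 1 :=
  quadraticChar_ne_one (by rw [ZMod.ringChar_zmod_n]; exact hp)

theorem sum_quadraticChar_discriminant (hp : p ≠ 2) :
    ∑ x : ZMod p, ∑ y : ZMod p, quadraticChar (ZMod p) (x ^ 2 + 4 * y) = 0 := by
  have h2 := zmod_two_ne_zero hp
  have h4 : (4 : ZMod p) ≠ 0 := by
    rw [show (4 : ZMod p) = 2 * 2 by norm_num]; exact mul_ne_zero h2 h2
  refine Finset.sum_eq_zero fun x _ => ?_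
  rw [← MulChar.sum_eq_zero_of_ne_one (quadraticChar_zmod_ne_one hp)]
  exact Equiv.sum_comp ((Equiv.mulLeft₀ 4 h4).trans (Equiv.addLeft (x ^ 2)))
    (fun z => quadraticChar (ZMod p) z)

theorem sum_quadraticChar_neg (hp : p ≠ 2) :
    ∑ _x : ZMod p, ∑ y : ZMod p, quadraticChar (ZMod p) (-y) = 0 := by
  refine Finset.sum_eq_zero fun x _ => ?_
  rw [← MulChar.sum_eq_zero_of_ne_one (quadraticChar_zmod_ne_one hp)]
  exact Equiv.sum_comp (Equiv.neg (ZMod p)) (fun z => quadraticChar (ZMod p) z)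

/-- The row `x = 0` contributes `χ(-1)(p-1)`; each of the other `p - 1` rows is the Jacobi sum `J(χ,
χ⁻¹) = -χ(-1)`. -/
theorem sum_quadraticChar_discriminant_mul_neg (hp : p ≠ 2) :
    ∑ x : ZMod p, ∑ y : ZMod p,
      quadraticChar (ZMod p) (x ^ 2 + 4 * y) * quadraticChar (ZMod p) (-y) = 0 := by
  have h2 := zmod_two_ne_zero hp
  have h4 : (4 : ZMod p) ≠ 0 := by
    rw [show (4 : ZMod p) = 2 * 2 by norm_num]; exact mul_ne_zero h2 h2
  have hχ4 : quadraticChar (ZMod p) 4 = 1 := by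
    rw [show (4 : ZMod p) = 2 ^ 2 by norm_num]; exact quadraticChar_sq_one' h2
  have hzero : ∑ y : ZMod p, quadraticChar (ZMod p) ((0 : ZMod p) ^ 2 + 4 * y) *
      quadraticChar (ZMod p) (-y) = quadraticChar (ZMod p) (-1) * (p - 1) := by
    have : ∀ y : ZMod p, quadraticChar (ZMod p) ((0 : ZMod p) ^ 2 + 4 * y) *
        quadraticChar (ZMod p) (-y) = quadraticChar (ZMod p) (-1) * (if y = 0 then 0 else 1) := by
      intro y
      rw [show (0 : ZMod p) ^ 2 + 4 * y = 4 * y by ring, neg_eq_neg_one_mul y, map_mul, map_mul, hχ4]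
      by_cases hy : y = 0
      · simp [hy]
      · have := quadraticChar_sq_one hy
        rw [if_neg hy]
        linear_combination quadraticChar (ZMod p) (-1) * this
    rw [Finset.sum_congr rfl fun y _ => this y, ← Finset.mul_sum]
    congr 1
    rw [Finset.sum_ite]
    simp only [Finset.sum_const_zero, zero_add, Finset.sum_const, nsmul_eq_mul, mul_one]
    rw [Finset.filter_ne' Finset.univ (0 : ZMod p), Finset.card_erase_of_mem (Finset.mem_univ _),
      Finset.card_univ, ZMod.card, Nat.cast_sub (Fact.out : p.Prime).one_le]
    simp
  have hne : ∀ x : ZMod p, x ≠ 0 → ∑ y : ZMod p, quadraticChar (ZMod p) (x ^ 2 + 4 * y) *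
      quadraticChar (ZMod p) (-y) = -quadraticChar (ZMod p) (-1) := by
    intro x hx
    have hJ := jacobiSum_nontrivial_inv (quadraticChar_zmod_ne_one hp)
    rw [(quadraticChar_isQuadratic (ZMod p)).inv, jacobiSum] at hJ
    rw [← hJ]
    have hk : -(x ^ 2 / 4) ≠ 0 := neg_ne_zero.2 (div_ne_zero (pow_ne_zero 2 hx) h4)
    -- Substituting `y = -(x^2/4) t` turns the two arguments into squares times `1 - t` and `t`.
    rw [← Equiv.sum_comp (Equiv.mulLeft₀ _ hk)]
    refine Finset.sum_congr rfl fun t _ => ?_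
    have e1 : x ^ 2 + 4 * (-(x ^ 2 / 4) * t) = x ^ 2 * (1 - t) := by field_simp; ring
    have e2 : -(-(x ^ 2 / 4) * t) = (x / 2) ^ 2 * t := by
      rw [div_pow]; norm_num
    have e0 : Equiv.mulLeft₀ _ hk t = -(x ^ 2 / 4) * t := rfl
    rw [e0, e1, e2, map_mul, map_mul, quadraticChar_sq_one' hx,
      quadraticChar_sq_one' (div_ne_zero hx h2)]
    ring
  rw [← Finset.add_sum_erase _ _ (Finset.mem_univ (0 : ZMod p)), hzero,
    Finset.sum_congr rfl fun x hx => hne x (Finset.ne_of_mem_erase hx), Finset.sum_const,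
    Finset.card_erase_of_mem (Finset.mem_univ _), Finset.card_univ, ZMod.card, nsmul_eq_mul,
    Nat.cast_sub (Fact.out : p.Prime).one_le]
  push_cast
  ring

end CharacterSums

theorem jacobiSym_val {m : ℕ} [NeZero m] (a : ℤ) :
    jacobiSym a m = jacobiSym ((a : ZMod m).val : ℤ) m := by
  rw [ZMod.val_intCast, ← jacobiSym.mod_left]

theorem jacobiSym_prime_mul {p m : ℕ} [Fact p.Prime] [NeZero m] (a : ℤ) :
    jacobiSym a (p * m) =
      quadraticChar (ZMod p) (a : ZMod p) * jacobiSym ((a : ZMod m).val : ℤ) m := by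
  have : NeZero p := ⟨(Fact.out : p.Prime).ne_zero⟩
  rw [jacobiSym.mul_right, ← jacobiSym.legendreSym.to_jacobiSym, ← jacobiSym_val]
  rfl

theorem sum_jacobiSym_weight {p m : ℕ} [Fact p.Prime] [NeZero m] (hp : p ≠ 2) (h : p.Coprime m) :
    ∑ b ∈ Finset.range (p * m), ∑ c ∈ Finset.range (p * m),
      (1 - jacobiSym ((b : ℤ) ^ 2 + 4 * c) (p * m)) * (1 + jacobiSym (-(c : ℤ)) (p * m)) =
      ((p * m : ℕ) : ℤ) ^ 2 := by
  have : NeZero p := ⟨(Fact.out : p.Prime).ne_zero⟩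
  have e1 := sum_range_sum_range_eq_zero h _
    (fun x y => jacobiSym ((x ^ 2 + 4 * y : ZMod m).val : ℤ) m) (sum_quadraticChar_discriminant hp)
  have e2 := sum_range_sum_range_eq_zero h _
    (fun _ y => jacobiSym ((-y : ZMod m).val : ℤ) m) (sum_quadraticChar_neg hp)
  have e3 := sum_range_sum_range_eq_zero h _
    (fun x y => jacobiSym ((x ^ 2 + 4 * y : ZMod m).val : ℤ) m * jacobiSym ((-y : ZMod m).val : ℤ) m)
    (sum_quadraticChar_discriminant_mul_neg hp)
  have e0 : ∑ b ∈ Finset.range (p * m), ∑ c ∈ Finset.range (p * m), (1 : ℤ) =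
      ((p * m : ℕ) : ℤ) ^ 2 := by
    simp; ring
  rw [← e0]
  -- Expanding the weight leaves `1` and three terms whose sums vanish by `e1`, `e2`, `e3`.
  refine Eq.trans ?_ (congrArg (fun z => _ - z) e1 |>.trans (sub_zero _))
  rw [← add_zero (_ - _), ← e2, ← sub_zero (_ + _), ← e3]
  simp only [← Finset.sum_sub_distrib, ← Finset.sum_add_distrib]
  refine Finset.sum_congr rfl fun b _ => Finset.sum_congr rfl fun c _ => ?_
  rw [jacobiSym_prime_mul, jacobiSym_prime_mul]
  push_cast
  ring

theorem one_lt_gcd_lt_or_dvd {a n : ℕ} (hn : 0 < n) (h : a.gcd n ≠ 1) :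
    (1 < a.gcd n ∧ a.gcd n < n) ∨ n ∣ a := by
  have h0 : 0 < a.gcd n := Nat.gcd_pos_of_pos_right _ hn
  have h1 : a.gcd n ≤ n := Nat.gcd_le_right _ hn
  rcases h1.lt_or_eq with h2 | h2
  · left; omega
  · right; rw [← h2]; exact Nat.gcd_dvd_left _ _

theorem weight_le_four {α β : ℤ} (hα : α = 0 ∨ α = 1 ∨ α = -1) (hβ : β = 0 ∨ β = 1 ∨ β = -1) :
    (1 - α) * (1 + β) ≤ 4 ∧ (¬ (α = -1 ∧ β = 1) → α ≠ 0 → β ≠ 0 → (1 - α) * (1 + β) = 0) := by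
  rcases hα with rfl | rfl | rfl <;> rcases hβ with rfl | rfl | rfl <;> norm_num

/-- Each weight is at most `4`, and it vanishes off the pairs counted by `M(n)` unless `n` divides
`D` or `c`. Each exception fixes `c` in terms of `b`, costing at most `n` pairs. -/
theorem sq_le_qftPairCount {n p : ℕ} (hodd : Odd n) (hsq : Squarefree n) (hp : p.Prime)
    (hpn : p ∣ n) : n ^ 2 ≤ 4 * qftPairCount n + 8 * n := by
  classical
  obtain ⟨m, rfl⟩ := hpn
  have hpos : 0 < p * m := hodd.pos
  have hm : NeZero m := ⟨by rintro rfl; simp at hpos⟩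
  have : NeZero (p * m) := ⟨hpos.ne'⟩
  have : Fact p.Prime := ⟨hp⟩
  have hp2 : p ≠ 2 := by
    rintro rfl
    exact (Nat.not_even_iff_odd.2 hodd) (even_two_mul m)
  have hcop : p.Coprime m := Nat.coprime_of_squarefree_mul hsq
  have hsum := sum_jacobiSym_weight hp2 hcop
  generalize p * m = n at *
  let P : ℕ × ℕ → Prop := fun q => QFTParams n (q.1 : ℤ) (q.2 : ℤ) ∨
      (1 < Nat.gcd (q.1 ^ 2 + 4 * q.2) n ∧ Nat.gcd (q.1 ^ 2 + 4 * q.2) n < n) ∨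
      (1 < Nat.gcd q.2 n ∧ Nat.gcd q.2 n < n)
  let T := Finset.range n ×ˢ Finset.range n
  have hcount : qftPairCount n = (T.filter P).card := by
    rw [qftPairCount, ← Set.ncard_coe_finset]
    congr 1
    ext q
    simp [T, P, and_assoc]
  have hDcard : (T.filter (fun q => n ∣ q.1 ^ 2 + 4 * q.2)).card ≤ n := by
    refine (Finset.card_le_card_of_injOn (t := Finset.range n) Prod.fst (fun q hq => ?_) ?_).trans_eq
      (Finset.card_range n)
    · exact (Finset.mem_product.1 (Finset.mem_filter.1 hq).1).1
    · rintro ⟨b, c⟩ hq ⟨b', c'⟩ hq' hbb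
      simp only at hbb
      subst hbb
      have h1 := Finset.mem_filter.1 hq
      have h2 := Finset.mem_filter.1 hq'
      simp only [T, Finset.mem_product, Finset.mem_range] at h1 h2
      have hc4 : (4 * c) ≡ (4 * c') [MOD n] :=
        Nat.ModEq.add_left_cancel' (b ^ 2)
          (((Nat.modEq_zero_iff_dvd).2 h1.2).trans ((Nat.modEq_zero_iff_dvd).2 h2.2).symm)
      have hn4 : n.gcd 4 = 1 := by
        have : Nat.Coprime n (2 ^ 2) := Nat.Coprime.pow_right 2 (Nat.coprime_two_right.2 hodd)
        simpa using this
      have := (Nat.ModEq.cancel_left_of_coprime hn4 hc4).eq_of_lt_of_lt h1.1.2 h2.1.2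
      rw [this]
  have hCcard : (T.filter (fun q => n ∣ q.2)).card ≤ n := by
    refine (Finset.card_le_card_of_injOn (t := Finset.range n) Prod.fst (fun q hq => ?_) ?_).trans_eq
      (Finset.card_range n)
    · exact (Finset.mem_product.1 (Finset.mem_filter.1 hq).1).1
    · rintro ⟨b, c⟩ hq ⟨b', c'⟩ hq' hbb
      have h1 := Finset.mem_filter.1 hq
      have h2 := Finset.mem_filter.1 hq'
      simp only [T, Finset.mem_product, Finset.mem_range] at h1 h2
      exact Prod.ext hbb ((Nat.eq_zero_of_dvd_of_lt h1.2 h1.1.2).trans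
        (Nat.eq_zero_of_dvd_of_lt h2.2 h2.1.2).symm)
  have hpt : ∀ q ∈ T, (1 - jacobiSym ((q.1 : ℤ) ^ 2 + 4 * q.2) n) * (1 + jacobiSym (-(q.2 : ℤ)) n) ≤
      (if P q then 4 else 0) + (if n ∣ q.1 ^ 2 + 4 * q.2 then 4 else 0) +
        (if n ∣ q.2 then 4 else 0) := by
    intro q _
    obtain ⟨hle, hz⟩ := weight_le_four (jacobiSym.trichotomy ((q.1 : ℤ) ^ 2 + 4 * q.2) n)
      (jacobiSym.trichotomy (-(q.2 : ℤ)) n)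
    have a1 : (0 : ℤ) ≤ if P q then 4 else 0 := by split_ifs <;> norm_num
    have a2 : (0 : ℤ) ≤ if n ∣ q.1 ^ 2 + 4 * q.2 then 4 else 0 := by split_ifs <;> norm_num
    have a3 : (0 : ℤ) ≤ if n ∣ q.2 then 4 else 0 := by split_ifs <;> norm_num
    by_cases hq : jacobiSym ((q.1 : ℤ) ^ 2 + 4 * q.2) n = -1 ∧ jacobiSym (-(q.2 : ℤ)) n = 1
    · have : P q := Or.inl hq
      rw [if_pos this]; linarith
    by_cases hD : jacobiSym ((q.1 : ℤ) ^ 2 + 4 * q.2) n = 0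
    · rw [jacobiSym.eq_zero_iff_not_coprime] at hD
      have hD' : (q.1 ^ 2 + 4 * q.2).gcd n ≠ 1 := by
        rw [← Int.gcd_natCast_natCast]; push_cast; exact hD
      rcases one_lt_gcd_lt_or_dvd hpos hD' with h | h
      · have : P q := Or.inr (Or.inl h)
        rw [if_pos this]; linarith
      · rw [if_pos h]; linarith
    by_cases hC : jacobiSym (-(q.2 : ℤ)) n = 0
    · rw [jacobiSym.eq_zero_iff_not_coprime] at hC
      have hC' : (q.2).gcd n ≠ 1 := by
        rw [← Int.gcd_natCast_natCast, ← Int.neg_gcd]; exact hC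
      rcases one_lt_gcd_lt_or_dvd hpos hC' with h | h
      · have : P q := Or.inr (Or.inr h)
        rw [if_pos this]; linarith
      · rw [if_pos h]; linarith
    rw [hz hq hD hC]; linarith
  have htot := Finset.sum_le_sum hpt
  rw [Finset.sum_product, hsum, Finset.sum_add_distrib, Finset.sum_add_distrib, ← Finset.sum_filter,
    ← Finset.sum_filter, ← Finset.sum_filter, Finset.sum_const, Finset.sum_const, Finset.sum_const,
    ← hcount] at htot
  simp only [nsmul_eq_mul] at htot
  have hD' : (((T.filter (fun q => n ∣ q.1 ^ 2 + 4 * q.2)).card : ℕ) : ℤ) ≤ n := by exact_mod_cast hDcard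
  have hC' : (((T.filter (fun q => n ∣ q.2)).card : ℕ) : ℤ) ≤ n := by exact_mod_cast hCcard
  have : (n : ℤ) ^ 2 ≤ 4 * qftPairCount n + 8 * n := by linarith
  exact_mod_cast this

/-! ### Trial division, boundary pairs, and the non-squarefree case -/

theorem qftPairCount_pos {n : ℕ} (h1 : 1 < n) (hc : ¬ n.Prime) : 0 < qftPairCount n := by
  have hlt : n.minFac < n := (Nat.not_prime_iff_minFac_lt h1).1 hc
  have hp : n.minFac.Prime := Nat.minFac_prime h1.ne'
  refine (Set.ncard_pos (finite_of_lt (n := n) fun q hq => ⟨hq.1, hq.2.1⟩)).2 ⟨(0, n.minFac), ?_⟩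
  refine ⟨by omega, hlt, Or.inr (Or.inr ?_)⟩
  simp only [Nat.gcd_eq_left (Nat.minFac_dvd n)]
  exact ⟨hp.one_lt, hlt⟩

theorem PassesQFT.lt_of_prime_dvd {B n : ℕ} {b c : ℤ} (h1 : 1 < n) (hc : ¬ n.Prime)
    (h : PassesQFT B n b c) : B < n.minFac := by
  by_contra hB
  refine h.step1 n.minFac (Nat.minFac_prime h1.ne') (le_min (not_lt.1 hB) ?_) (Nat.minFac_dvd n)
  rw [Nat.le_sqrt']
  exact Nat.minFac_sq_le_self (by omega) hc

/-- The range `0 ≤ b, c ≤ n` repeats the residue `0`. Passing excludes `c = n`, so only the column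
`b = n` is extra. -/
theorem qftPassCount_le (B n : ℕ) (h1 : 1 < n) :
    qftPassCount B n ≤ (passPairs B n).ncard + (n + 1) := by
  have hsub : {q : ℕ × ℕ | q.1 ≤ n ∧ q.2 ≤ n ∧ PassesQFT B n (q.1 : ℤ) (q.2 : ℤ)} ⊆
      passPairs B n ∪ (fun c => (n, c)) '' {c : ℕ | c ≤ n} := by
    rintro ⟨b, c⟩ ⟨hb, hc, h⟩
    simp only at hb hc h
    have hcn : c ≠ n := by
      rintro rfl
      have := (h.cast_ne_zero (by omega) (Nat.minFac_prime h1.ne') (Nat.minFac_dvd c)).1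
      apply this
      rw [Int.cast_natCast, ZMod.natCast_eq_zero_iff]
      exact Nat.minFac_dvd c
    rcases hb.lt_or_eq with hb | rfl
    · exact Or.inl ⟨hb, lt_of_le_of_ne hc hcn, h⟩
    · exact Or.inr ⟨c, hc, rfl⟩
  have hf1 : (passPairs B n).Finite := finite_of_lt (n := n) fun q hq => ⟨hq.1, hq.2.1⟩
  have hf2 : {c : ℕ | c ≤ n}.Finite := Set.finite_le_nat n
  refine (Set.ncard_le_ncard hsub (hf1.union (hf2.image _))).trans ?_
  refine (Set.ncard_union_le _ _).trans (Nat.add_le_add_left ?_ _)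
  refine (Set.ncard_image_le hf2).trans_eq ?_
  have : {c : ℕ | c ≤ n} = (Finset.range (n + 1) : Set ℕ) := by ext; simp
  rw [this, Set.ncard_coe_finset, Finset.card_range]

theorem ncard_passPairs_le_sq {B n m p : ℕ} (h1 : 1 < n) (hnm : n = m * p) (hpm : p ∣ m) :
    (passPairs B n).ncard ≤ m ^ 2 := by
  have hm : 0 < m := by rcases Nat.eq_zero_or_pos m with rfl | h <;> omega
  have hT : ((Finset.range m ×ˢ Finset.range m : Finset (ℕ × ℕ)) : Set (ℕ × ℕ)).ncard = m ^ 2 := by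
    rw [Set.ncard_coe_finset, Finset.card_product, Finset.card_range, sq]
  rw [← hT]
  refine Set.ncard_le_ncard_of_injOn (fun q => (q.1 % m, q.2 % m)) ?_ ?_ (Finset.finite_toSet _)
  · intro q _
    simp [Nat.mod_lt _ hm]
  · rintro ⟨b, c⟩ ⟨hb, hc, h⟩ ⟨b', c'⟩ ⟨hb', hc', h'⟩ heq
    simp only [Prod.mk.injEq] at heq hb hc h hb' hc' h'
    obtain ⟨β, hβ⟩ := (Nat.modEq_iff_dvd (n := m)).1 heq.1
    obtain ⟨γ, hγ⟩ := (Nat.modEq_iff_dvd (n := m)).1 heq.2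
    have eb : (b' : ℤ) = b + m * β := by linarith
    have ec : (c' : ℤ) = c + m * γ := by linarith
    rw [eb, ec] at h'
    obtain ⟨d1, d2⟩ := h.lift_unique h1 hnm hpm h'
    rw [← hβ] at d1
    rw [← hγ] at d2
    exact Prod.ext (Nat.ModEq.eq_of_lt_of_lt ((Nat.modEq_iff_dvd).2 d1) hb hb')
      (Nat.ModEq.eq_of_lt_of_lt ((Nat.modEq_iff_dvd).2 d2) hc hc')

/-- Any `b` with `c = i p`, `1 ≤ i < m`, has a nontrivial `gcd(c, n)`. -/
theorem mul_le_qftPairCount {n m p : ℕ} (hnm : n = m * p) (hp : p.Prime) :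
    n * (m - 1) ≤ qftPairCount n := by
  have hT : ((Finset.range n ×ˢ Finset.Ico 1 m : Finset (ℕ × ℕ)) : Set (ℕ × ℕ)).ncard =
      n * (m - 1) := by
    rw [Set.ncard_coe_finset, Finset.card_product, Finset.card_range, Nat.card_Ico]
  rw [← hT]
  refine Set.ncard_le_ncard_of_injOn (fun q => (q.1, q.2 * p)) ?_ ?_
    (finite_of_lt (n := n) fun q hq => ⟨hq.1, hq.2.1⟩)
  · rintro ⟨b, i⟩ hq
    simp only [Finset.coe_product, Set.mem_prod, Finset.coe_range, Set.mem_Iio, Finset.coe_Ico,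
      Set.mem_Ico] at hq
    obtain ⟨hb, hi1, him⟩ := hq
    have hlt : i * p < n := by rw [hnm]; exact Nat.mul_lt_mul_of_pos_right him hp.pos
    have hip : 0 < i * p := Nat.mul_pos hi1 hp.pos
    refine ⟨hb, hlt, Or.inr (Or.inr ⟨?_, ?_⟩)⟩
    · refine lt_of_lt_of_le hp.one_lt (Nat.le_of_dvd (Nat.gcd_pos_of_pos_left _ hip) ?_)
      exact Nat.dvd_gcd (Dvd.intro_left i rfl) (hnm ▸ Dvd.intro_left m rfl)
    · exact lt_of_le_of_lt (Nat.gcd_le_left _ hip) hlt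
  · rintro ⟨b, i⟩ _ ⟨b', i'⟩ _ h
    simp only [Prod.mk.injEq] at h
    exact Prod.ext h.1 (Nat.eq_of_mul_eq_mul_right hp.pos h.2)

theorem passCount_lt_of_sq_dvd {B n p : ℕ} (h1 : 1 < n) (hp : p.Prime) (hpn : p * p ∣ n)
    (hB : 50000 ≤ B) (hBp : B < p) : B * qftPassCount B n < 4 * qftPairCount n := by
  obtain ⟨t, ht⟩ := hpn
  have htpos : 0 < t := by rcases Nat.eq_zero_or_pos t with rfl | h <;> omega
  obtain ⟨m, hm⟩ : ∃ m, m = p * t := ⟨_, rfl⟩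
  have hnm : n = m * p := by rw [ht, hm]; ring
  have hpm : p ≤ m := by rw [hm]; exact Nat.le_mul_of_pos_right p htpos
  have e1 := qftPassCount_le B n h1
  have e2 := ncard_passPairs_le_sq (B := B) h1 hnm ⟨t, hm⟩
  have e3 := mul_le_qftPairCount hnm hp
  obtain ⟨w, rfl⟩ : ∃ w, m = w + 1 := ⟨m - 1, by omega⟩
  rw [Nat.add_sub_cancel] at e3
  have e4 : qftPassCount B n ≤ (w + 1) ^ 2 + ((w + 1) * p + 1) := by rw [← hnm]; omega
  -- Since `p ≤ m = w + 1`, the left side is at most `2(w+1)^2 + 1`.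
  have e5 : (w + 1) ^ 2 + ((w + 1) * p + 1) < 4 * ((w + 1) * w) := by nlinarith
  calc B * qftPassCount B n ≤ p * qftPassCount B n := Nat.mul_le_mul_right _ hBp.le
    _ < p * (4 * ((w + 1) * w)) := Nat.mul_lt_mul_of_pos_left (e4.trans_lt e5) hp.pos
    _ = 4 * (n * w) := by rw [hnm]; ring
    _ ≤ _ := Nat.mul_le_mul_left _ e3

/-! ### Numerical bounds in the squarefree case and conclusion -/

/-- Two inert primes would give Jacobi symbol `(-1)(-1) = 1` instead of `-1`. -/
theorem inertPassPairs_eq_empty {B n : ℕ} (hsq : Squarefree n) (h2 : n.primeFactors.card = 2) :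
    inertPassPairs B n = ∅ := by
  rw [Set.eq_empty_iff_forall_notMem]
  rintro ⟨b, c⟩ ⟨⟨-, -, h⟩, hD⟩
  obtain ⟨p, q, hpq, hpf⟩ := Finset.card_eq_two.1 h2
  have hn : n = p * q := by
    rw [← Nat.prod_primeFactors_of_squarefree hsq, hpf, Finset.prod_pair hpq]
  have hp : p ∈ n.primeFactors := by rw [hpf]; simp
  have hq : q ∈ n.primeFactors := by rw [hpf]; simp
  have : Fact p.Prime := ⟨Nat.prime_of_mem_primeFactors hp⟩
  have : Fact q.Prime := ⟨Nat.prime_of_mem_primeFactors hq⟩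
  have key : ∀ l ∈ n.primeFactors, jacobiSym ((b : ℤ) ^ 2 + 4 * c) l = -1 := by
    intro l hl
    have : Fact l.Prime := ⟨Nat.prime_of_mem_primeFactors hl⟩
    rw [← jacobiSym.legendreSym.to_jacobiSym, legendreSym.eq_neg_one_iff]
    push_cast
    exact hD l hl
  have : NeZero p := ⟨(Fact.out : p.Prime).ne_zero⟩
  have : NeZero q := ⟨(Fact.out : q.Prime).ne_zero⟩
  have h1 := h.params.1
  rw [hn, jacobiSym.mul_right, key p hp, key q hq] at h1
  norm_num at h1

theorem mul_pow_le_of_three_le (k : ℕ) (hk : 3 ≤ k) :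
    (k : ℝ) * (3 / 10) ^ (k - 1) ≤ 27 / 100 := by
  induction k, hk using Nat.le_induction with
  | base => norm_num
  | succ m hm ih =>
    obtain ⟨i, rfl⟩ : ∃ i, m = i + 1 := ⟨m - 1, by omega⟩
    simp only [Nat.add_sub_cancel] at ih ⊢
    have : (0 : ℝ) < (3 / 10) ^ i := by positivity
    have hi : (2 : ℝ) ≤ i := by exact_mod_cast (by omega : 2 ≤ i)
    rw [pow_succ]
    push_cast at ih ⊢
    nlinarith

theorem inert_bound {n k J G A B : ℕ} (hk : 3 ≤ k) (hJ : 2 ≤ J) (hG : 0 < G)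
    (hA : 2 ^ k * A ≤ G * (1 + ∑ j ∈ Finset.range J, (2 ^ k) ^ j))
    (h : (n : ℝ) ^ 2 / (2 ^ (k * (J + 1)) * (G : ℝ)) > (B : ℝ) / 2 ^ (3 * k - 1)) :
    (B : ℝ) * A ≤ 9 / 14 * (n : ℝ) ^ 2 := by
  have hGR : (0 : ℝ) < G := by exact_mod_cast hG
  rw [gt_iff_lt, div_lt_div_iff₀ (by positivity) (by positivity)] at h
  have hAR : (2 : ℝ) ^ k * A ≤ G * (1 + ∑ j ∈ Finset.range J, ((2 : ℝ) ^ k) ^ j) := by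
    exact_mod_cast hA
  have e1 : (2 : ℝ) ^ (3 * k - 1) * 2 = ((2 : ℝ) ^ k) ^ 3 := by
    rw [← pow_succ, ← pow_mul]; congr 1; omega
  have e2 : (2 : ℝ) ^ (k * (J + 1)) = ((2 : ℝ) ^ k) ^ J * 2 ^ k := by
    rw [pow_mul, pow_succ]
  have ht8 : (8 : ℝ) ≤ 2 ^ k := by
    calc (8 : ℝ) = 2 ^ 3 := by norm_num
      _ ≤ 2 ^ k := pow_le_pow_right₀ (by norm_num) hk
  rw [e2] at h
  generalize (2 : ℝ) ^ k = t at *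
  have hgeo := mul_geom_sum t J
  have hY : t ^ 2 ≤ t ^ J := pow_le_pow_right₀ (by linarith) hJ
  generalize t ^ J = Y at *
  generalize ∑ j ∈ Finset.range J, t ^ j = S at *
  generalize (2 : ℝ) ^ (3 * k - 1) = u at *
  have hB0 : (0 : ℝ) ≤ B := Nat.cast_nonneg B
  have hA0 : (0 : ℝ) ≤ A := Nat.cast_nonneg A
  have t0 : (0 : ℝ) < t := by linarith
  -- The hypothesis rewritten with `t = 2^k`, `Y = t^J` and `2^(3k-1) = t^3/2`.
  have h1 : 2 * (B * (Y * G)) ≤ (n : ℝ) ^ 2 * t ^ 2 := by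
    have : t * (2 * (B * (Y * G))) ≤ t * ((n : ℝ) ^ 2 * t ^ 2) := by
      calc t * (2 * (B * (Y * G))) = 2 * (B * (Y * t * G)) := by ring
        _ ≤ 2 * ((n : ℝ) ^ 2 * u) := by linarith
        _ = (n : ℝ) ^ 2 * (u * 2) := by ring
        _ = t * ((n : ℝ) ^ 2 * t ^ 2) := by rw [e1]; ring
    exact le_of_mul_le_mul_left this t0
  -- The left side is `Y + t - 2`, and `8t ≤ t^2 ≤ Y`.
  have h2 : (t - 1) * (1 + S) ≤ 9 / 8 * Y := by nlinarith
  have h3 : t * ((t - 1) * (B * A)) ≤ t * (9 / 16 * (n : ℝ) ^ 2 * t) := by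
    calc t * ((t - 1) * (B * A)) = (B * (t - 1)) * (t * A) := by ring
      _ ≤ (B * (t - 1)) * (G * (1 + S)) :=
        mul_le_mul_of_nonneg_left hAR (mul_nonneg hB0 (by linarith))
      _ = (B * G) * ((t - 1) * (1 + S)) := by ring
      _ ≤ (B * G) * (9 / 8 * Y) := mul_le_mul_of_nonneg_left h2 (by positivity)
      _ = 9 / 16 * (2 * (B * (Y * G))) := by ring
      _ ≤ 9 / 16 * ((n : ℝ) ^ 2 * t ^ 2) := by linarith
      _ = _ := by ring
  have h4 := le_of_mul_le_mul_left h3 t0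
  -- As `t ≥ 8`, `t/(t-1) ≤ 8/7`, and `9/16 * 8/7 = 9/14`.
  have h5 : (t - 1) * (B * A) ≤ (t - 1) * (9 / 14 * (n : ℝ) ^ 2) := by
    nlinarith [sq_nonneg (n : ℝ)]
  exact le_of_mul_le_mul_left h5 (by linarith)

theorem ncard_passPairs_le_of_squarefree {n B : ℕ} (hodd : Odd n) (h1 : 1 < n) (hsq : Squarefree n)
    (hB : 50000 ≤ B) (hbig : ∀ p ∈ n.primeFactors, B < p) :
    (B : ℝ) * (passPairs B n).ncard ≤ B * (inertPassPairs B n).ncard +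
      (n : ℝ) ^ 2 * (n.primeFactors.card * (3 / 10) ^ (n.primeFactors.card - 1)) := by
  let U : ℕ → Set (ℕ × ℕ) := fun l =>
    {q ∈ passPairs B n | IsSquare ((q.1 : ZMod l) ^ 2 + 4 * (q.2 : ZMod l))}
  have hfin : (passPairs B n).Finite := finite_of_lt (n := n) fun q hq => ⟨hq.1, hq.2.1⟩
  have hsub : passPairs B n ⊆ inertPassPairs B n ∪ ⋃ l ∈ n.primeFactors, U l := by
    intro q hq
    by_cases h : ∀ p ∈ n.primeFactors, ¬ IsSquare ((q.1 : ZMod p) ^ 2 + 4 * (q.2 : ZMod p))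
    · exact Or.inl ⟨hq, h⟩
    · push Not at h
      obtain ⟨l, hl, hs⟩ := h
      right
      simp only [Set.mem_iUnion]
      exact ⟨l, hl, hq, hs⟩
  have hle : (passPairs B n).ncard ≤ (inertPassPairs B n).ncard +
      ∑ l ∈ n.primeFactors, (U l).ncard := by
    refine (Set.ncard_le_ncard hsub ((hfin.subset fun q hq => hq.1).union
      (n.primeFactors.finite_toSet.biUnion fun l _ => hfin.subset fun q hq => hq.1))).trans ?_
    exact (Set.ncard_union_le _ _).trans (Nat.add_le_add_left (Finset.set_ncard_biUnion_le _ _) _)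
  have hsum : ((∑ l ∈ n.primeFactors, (U l).ncard : ℕ) : ℝ) ≤
      n.primeFactors.card * ((n : ℝ) ^ 2 * ((3 / 10) ^ (n.primeFactors.card - 1) / B)) := by
    rw [Nat.cast_sum, ← nsmul_eq_mul]
    exact Finset.sum_le_card_nsmul _ _ _
      fun l hl => ncard_splitPassPairs_le hodd h1 hsq hl hB hbig
  have hBpos : (0 : ℝ) < B := by exact_mod_cast (by omega : 0 < B)
  have hle' : ((passPairs B n).ncard : ℝ) ≤ (inertPassPairs B n).ncard +
      ((∑ l ∈ n.primeFactors, (U l).ncard : ℕ) : ℝ) := by exact_mod_cast hle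
  calc (B : ℝ) * (passPairs B n).ncard ≤ B * ((inertPassPairs B n).ncard +
        n.primeFactors.card * ((n : ℝ) ^ 2 * ((3 / 10) ^ (n.primeFactors.card - 1) / B))) :=
        mul_le_mul_of_nonneg_left (hle'.trans (by linarith)) hBpos.le
    _ = _ := by field_simp

theorem eight_dvd_sq_sub_one {p : ℕ} (hp : Odd p) : 2 ^ 3 ∣ p ^ 2 - 1 := by
  obtain ⟨t, rfl⟩ := hp
  obtain ⟨w, hw⟩ := Nat.even_mul_succ_self t
  have : (2 * t + 1) ^ 2 = 8 * w + 1 := by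
    have : (2 * t + 1) ^ 2 = 4 * (t * (t + 1)) + 1 := by ring
    rw [this, hw]; ring
  exact ⟨w, by rw [this]; norm_num⟩

theorem two_le_card_primeFactors {n : ℕ} (h1 : 1 < n) (hc : ¬ n.Prime) (hsq : Squarefree n) :
    2 ≤ n.primeFactors.card := by
  have hprod := Nat.prod_primeFactors_of_squarefree hsq
  by_contra hk
  have : n.primeFactors.card = 0 ∨ n.primeFactors.card = 1 := by omega
  rcases this with h | h
  · rw [Finset.card_eq_zero.1 h, Finset.prod_empty] at hprod
    omega
  · obtain ⟨p, hp⟩ := Finset.card_eq_one.1 h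
    rw [hp, Finset.prod_singleton] at hprod
    exact hc (hprod ▸ Nat.prime_of_mem_primeFactors (n := n) (by rw [hp]; simp))

theorem theorem4p1 (n k r s G J B : ℕ)
    (hn_odd : Odd n) (hn_one : 1 < n) (hn_comp : ¬ n.Prime)
    (hk : k = n.primeFactors.card)
    (hs : Odd s) (hrs : n ^ 2 - 1 = 2 ^ r * s)
    (hG : G = ∏ p ∈ n.primeFactors, Nat.gcd (p ^ 2 - 1) s)
    (hJ : IsGreatest {j : ℕ | ∀ p ∈ n.primeFactors, 2 ^ (j + 1) ∣ p ^ 2 - 1} J)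
    (hB : 50000 ≤ B)
    (h : (n : ℝ) ^ 2 / (2 ^ (k * (J + 1)) * (G : ℝ)) > (B : ℝ) / 2 ^ (3 * k - 1)) :
    0 < qftPairCount n ∧ rqftProb B n < 4 / (B : ℝ) := by
  have hM := qftPairCount_pos hn_one hn_comp
  refine ⟨hM, ?_⟩
  have hBpos : (0 : ℝ) < B := by exact_mod_cast (by omega : 0 < B)
  have hMR : (0 : ℝ) < qftPairCount n := by exact_mod_cast hM
  suffices hmain : (B : ℝ) * qftPassCount B n < 4 * qftPairCount n by
    rw [rqftProb, div_lt_div_iff₀ hMR hBpos]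
    linarith
  rcases Nat.eq_zero_or_pos (qftPassCount B n) with h0 | hpos
  · rw [h0]; simpa using hM
  obtain ⟨q, -, -, hq⟩ := Set.nonempty_of_ncard_ne_zero hpos.ne'
  have hmin := hq.lt_of_prime_dvd hn_one hn_comp
  have hbig : ∀ p ∈ n.primeFactors, B < p := fun p hp =>
    hmin.trans_le (Nat.minFac_le_of_dvd (Nat.prime_of_mem_primeFactors hp).two_le
      (Nat.dvd_of_mem_primeFactors hp))
  by_cases hsq : Squarefree n
  swap
  · rw [Nat.squarefree_iff_prime_squarefree] at hsq
    push Not at hsq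
    obtain ⟨p, hp, hpn⟩ := hsq
    have hBp : B < p := hbig p (Nat.mem_primeFactors.2 ⟨hp, (Dvd.intro _ rfl).trans hpn, by omega⟩)
    exact_mod_cast passCount_lt_of_sq_dvd hn_one hp hpn hB hBp
  have hk2 := two_le_card_primeFactors hn_one hn_comp hsq
  have hpass := ncard_passPairs_le_of_squarefree hn_odd hn_one hsq hB hbig
  -- For `k = 2` the split pairs alone give `2 * 3/10`; for `k ≥ 3` the total is `9/14 + 27/100 <
  -- 92/100`.
  have hmainle : (B : ℝ) * (passPairs B n).ncard ≤ 92 / 100 * (n : ℝ) ^ 2 := by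
    rw [← hk] at hpass hk2
    have hn2 : (0 : ℝ) ≤ (n : ℝ) ^ 2 := by positivity
    rcases hk2.eq_or_lt with hk2 | hk3
    · rw [inertPassPairs_eq_empty hsq (hk2.trans hk).symm, ← hk2] at hpass
      norm_num at hpass
      linarith
    · have hJ2 : 2 ≤ J := hJ.2 fun p hp =>
        eight_dvd_sq_sub_one (hn_odd.of_dvd_nat (Nat.dvd_of_mem_primeFactors hp))
      have hGpos : 0 < G := by
        rw [hG]; exact Finset.prod_pos fun p _ => Nat.gcd_pos_of_pos_right _ hs.pos
      have hin := two_pow_mul_ncard_inertPassPairs_le (B := B) hn_odd hsq hs hrs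
        (fun j hj => hJ.2 hj)
      rw [← hk, ← hG] at hin
      have hA := inert_bound hk3 hJ2 hGpos hin h
      have := mul_le_mul_of_nonneg_left (mul_pow_le_of_three_le k hk3) hn2
      linarith
  have hMle := sq_le_qftPairCount hn_odd hsq (Nat.minFac_prime hn_one.ne') (Nat.minFac_dvd n)
  have hMleR : (n : ℝ) ^ 2 ≤ 4 * qftPairCount n + 8 * n := by exact_mod_cast hMle
  have hcount : (qftPassCount B n : ℝ) ≤ (passPairs B n).ncard + (n + 1) := by
    exact_mod_cast qftPassCount_le B n hn_one
  have hnB : (B : ℝ) ^ 2 ≤ n := by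
    have : B ^ 2 ≤ n := (Nat.pow_le_pow_left hmin.le 2).trans
      (Nat.minFac_sq_le_self (by omega) hn_comp)
    exact_mod_cast this
  have hB' : (50000 : ℝ) ≤ B := by exact_mod_cast hB
  have hBn : 50000 * (B : ℝ) ≤ n := by nlinarith
  have hn1 : (1 : ℝ) ≤ n := by linarith
  have h3 : (B : ℝ) * qftPassCount B n ≤ 92 / 100 * (n : ℝ) ^ 2 + B * (n + 1) := by
    have := mul_le_mul_of_nonneg_left hcount hBpos.le
    linarith
  -- Because `n ≥ 50000 B`, the terms `B(n+1)` and `8n` fit in the remaining `8/100 n^2`.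
  nlinarith
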